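/- All groups are finite. For a group $G$, let $F(G)$ be its Fitting subgroup, i.e. the subgroup generated by all normal nilpotent subgroups of $G$, and call $G$ $\mathcal N$-constrained if $C_G(F(G))\le F(G)$. A nilpotent injector of $G$ is a subgroup $I\le G$ such that, for every subnormal subgroup $S$ of $G$, $S\cap I$ is a maximal nilpotent subgroup of $S$. Put $m_G=1$ if $G$ is nilpotent, and otherwise $$m_G=\gcd\{\,p-1 : p \text{ prime},\ p\mid (G:I)\text{ with } I \text{ a nilpotent injector of } G\,\}.$$ For a finite poset $P$, its Möbius function $\mu_P:P\times P\to\mathbb Z$ is defined by $\mu_P(x,y)=0$ if $x\not\le y$, $\mu_P(x,x)=1$, and $\mu_P(x,y)=-\sum_{x\le z<y}\mu_P(x,z)$ if $x<y$; put $\theta_P(x)=\sum_{y\in P}\mu_P(x,y)$. Let $G$ be a nontrivial finite $\mathcal N$-constrained group, let $I$ be a nilpotent injector of $G$, and let $\mathcal X$ be the set of all subgroups of $G$ that are contained in some conjugate of $I$, ordered by inclusion. Let $n=(I:F(G))$ and suppose $n>1$. Then $F(G)\in\mathcal X$, and $\mathrm{lcm}(m_G,n)$ divides $\theta_{\mathcal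 X}(F(G))$. -/

import Mathlib

/-- The Fitting subgroup of a (finite) group: the subgroup generated by all normal nilpotent
subgroups. -/
def fittingSubgroup (G : Type*) [Group G] : Subgroup G :=
  sSup {N : Subgroup G | N.Normal ∧ Group.IsNilpotent N}

/-- `G` is `𝒩`-constrained: the Fitting subgroup contains its own centralizer in `G`. -/
def IsNConstrained (G : Type*) [Group G] : Prop :=
  Subgroup.centralizer (fittingSubgroup G : Set G) ≤ fittingSubgroup G

/-- `I` is a nilpotent injector of `G`: for every subnormal subgroup `S` of `G`, the intersection
`S ∩ I` is maximal among the nilpotent subgroups of `S`. -/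
def IsNilpotentInjector {G : Type*} [Group G] (I : Subgroup G) : Prop :=
  ∀ S : Subgroup G, S.IsSubnormal →
    Maximal (fun K : Subgroup G => K ≤ S ∧ Group.IsNilpotent K) (S ⊓ I)

open Classical in
/-- The number `m_G` of a finite group `G`: it is `1` if `G` is nilpotent, and otherwise the
greatest common divisor of the numbers `p - 1`, where `p` runs over the primes dividing `(G : I)`
with `I` a nilpotent injector of `G` (such primes divide the order of `G`). -/
noncomputable def injectorModulus (G : Type*) [Group G] : ℕ :=
  if Group.IsNilpotent G then 1
  else
    ((Nat.card G).primeFactors.filter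
      (fun p => ∃ I : Subgroup G, IsNilpotentInjector I ∧ p ∣ I.index)).gcd (fun p => p - 1)

/-- The set of all subgroups of `G` that are contained in some conjugate of `I`. -/
def subgroupsOfConjugates {G : Type*} [Group G] (I : Subgroup G) : Set (Subgroup G) :=
  {H | ∃ g : G, H ≤ I.map (MulAut.conj g).toMonoidHom}

open Classical in
/-- The Möbius function `μ_P` of a finite poset `P`. -/
noncomputable def posetMoebius {P : Type*} [PartialOrder P] [Finite P] (x y : P) : ℤ :=
  letI : Fintype P := Fintype.ofFinite P
  letI : LocallyFiniteOrder P := Fintype.toLocallyFiniteOrder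
  IncidenceAlgebra.mu ℤ x y

/-- `θ_P(x) = ∑_{y ∈ P} μ_P(x, y)` for a finite poset `P`. -/
noncomputable def posetTheta {P : Type*} [PartialOrder P] [Finite P] (x : P) : ℤ :=
  ∑ᶠ y : P, posetMoebius x y

/-! Write F = F(G). On a finite poset θ is the unique function whose sum over every upper set {z ≥
x} is 1. Hence θ(F) depends only on the members of X above F, and θ can be transported along Galois
connections.

In G/F let C_p and D_p be the images of the centralizers of the p'-elements and of the p-elements of
F. The constraint C_G(F) ≤ F forces C_p ∩ D_p = 1 and [C_p, D_p] = 1, and C_q ≤ D_p for q ≠ p. A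
subgroup K ≥ F is nilpotent exactly when, for every prime q, the q-elements of K/F lie in C_q
(`map_mem_primewiseIn`, `isNilpotent_comap`). By Sylow's theorem in each C_q, the maximal subgroups
of this kind are conjugate, so they all come from conjugates of I. The part of X above F is
therefore the poset `primewiseIn`, and K ↦ (K ∩ C_p, K ∩ D_p) shows that θ(F) is a multiple of θ(1)
in the poset of p-subgroups of C_p (`primewiseIn.posetTheta_dvd`).

For p-subgroups A of a finite group H, ∑ |A| θ(A) is the number of p-elements of H, and θ(A) equals
θ(1) for N_H(A)/A, so induction on |H| isolates θ(1). Frobenius' theorem gives |H|_p ∣ θ(1). If p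
divides |H| and m divides q - 1 for all other primes q dividing |H|, the same sum read modulo m
gives m ∣ θ(1). Take H = C_p: a Sylow p-subgroup of I/F lies in C_p, which yields n; primes q ≠ p
dividing |C_p| divide (G:I), which yields m_G. -/

/-! ### The function θ of a finite poset -/

open Classical in
theorem sum_posetTheta_ge {P : Type*} [PartialOrder P] [Fintype P] (x : P) :
    ∑ z : P with x ≤ z, posetTheta z = 1 := by
  have key : ∀ y : P, ∑ z : P with x ≤ z, posetMoebius z y = if x = y then 1 else 0 := by
    intro y
    unfold posetMoebius
    let _ : Fintype P := Fintype.ofFinite P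
    let _ : LocallyFiniteOrder P := Fintype.toLocallyFiniteOrder
    rw [← IncidenceAlgebra.sum_Icc_mu_left (𝕜 := ℤ) x y]
    symm
    refine Finset.sum_subset_zero_on_sdiff ?_ ?_ ?_
    · intro z hz
      rw [Finset.mem_Icc] at hz
      simp [hz.1]
    · intro z hz
      simp only [Finset.mem_sdiff, Finset.mem_filter, Finset.mem_univ, true_and,
        Finset.mem_Icc, not_and] at hz
      exact IncidenceAlgebra.apply_eq_zero_of_not_le (hz.2 hz.1) _
    · intro z _
      rfl
  simp only [posetTheta, finsum_eq_sum_of_fintype]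
  rw [Finset.sum_comm]
  simp [key]

-- The upper-set sums determine a function by induction from the maximal elements downwards.
open Classical in
theorem eq_posetTheta {P : Type*} [PartialOrder P] [Fintype P] (h : P → ℤ)
    (hh : ∀ x, ∑ z : P with x ≤ z, h z = 1) (x : P) : h x = posetTheta x := by
  induction x using WellFoundedGT.induction with
  | ind x ih =>
    have hs : (Finset.univ.filter fun z : P => x ≤ z)
        = insert x (Finset.univ.filter fun z : P => x < z) := by
      ext z
      simp [le_iff_eq_or_lt, eq_comm]
    have h1 := (hh x).trans (sum_posetTheta_ge x).symm
    rw [hs, Finset.sum_insert (by simp), Finset.sum_insert (by simp),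
      Finset.sum_congr rfl fun z hz => ih z (by simpa using hz)] at h1
    exact add_right_cancel h1

open Classical in
/-- Pushforward of `posetTheta` along the upper adjoint of a Galois connection. -/
theorem posetTheta_eq_sum_of_galois {P Q : Type*} [PartialOrder P] [Fintype P] [PartialOrder Q]
    [Fintype Q] {j : Q → P} {f : P → Q} (gc : ∀ q a, j q ≤ a ↔ q ≤ f a) (b : Q) :
    posetTheta b = ∑ a : P with f a = b, posetTheta a := by
  symm
  refine eq_posetTheta (fun b => ∑ a : P with f a = b, posetTheta a) (fun x => ?_) b
  rw [← sum_posetTheta_ge (j x)]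
  simp only [Finset.sum_filter, gc]
  rw [← Finset.sum_fiberwise Finset.univ f]
  refine Finset.sum_congr rfl fun b _ => ?_
  rw [Finset.sum_filter]
  split_ifs with hb
  · exact Finset.sum_congr rfl fun a _ => by split_ifs <;> simp_all
  · exact (Finset.sum_eq_zero fun a _ => by split_ifs <;> simp_all).symm

theorem posetTheta_eq_of_galois {P Q : Type*} [PartialOrder P] [Finite P] [PartialOrder Q]
    [Finite Q] {j : Q → P} {f : P → Q} (gc : ∀ q a, j q ≤ a ↔ q ≤ f a) {b : Q} {a₀ : P}
    (h : ∀ a, f a = b ↔ a = a₀) : posetTheta b = posetTheta a₀ := by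
  classical
  let _ : Fintype P := Fintype.ofFinite P
  let _ : Fintype Q := Fintype.ofFinite Q
  rw [posetTheta_eq_sum_of_galois gc b, Finset.filter_congr fun a _ => h a,
    Finset.sum_filter, Finset.sum_ite_eq' Finset.univ a₀, if_pos (Finset.mem_univ _)]

/-- Embeddings onto upper sets preserve `posetTheta`. -/
theorem posetTheta_upper {P Q : Type*} [PartialOrder P] [Finite P] [PartialOrder Q]
    [Finite Q] (e : P ↪o Q) (h : ∀ x y, e x ≤ y → ∃ z, e z = y) (x : P) :
    posetTheta (e x) = posetTheta x := by
  classical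
  let _ : Fintype P := Fintype.ofFinite P
  let _ : Fintype Q := Fintype.ofFinite Q
  refine eq_posetTheta (fun x => posetTheta (e x)) (fun x => ?_) x
  rw [← sum_posetTheta_ge (e x)]
  refine Finset.sum_bij (fun z _ => e z) ?_ ?_ ?_ ?_
  · intro a ha
    simpa using ha
  · intro a _ b _ hab
    exact e.injective hab
  · intro y hy
    simp only [Finset.mem_filter, Finset.mem_univ, true_and] at hy
    obtain ⟨z, rfl⟩ := h x y hy
    exact ⟨z, by simpa using hy, rfl⟩
  · intros
    rfl

theorem posetTheta_prod {P Q : Type*} [PartialOrder P] [Finite P] [PartialOrder Q]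
    [Finite Q] (x : P × Q) : posetTheta x = posetTheta x.1 * posetTheta x.2 := by
  classical
  let _ : Fintype P := Fintype.ofFinite P
  let _ : Fintype Q := Fintype.ofFinite Q
  symm
  refine eq_posetTheta (fun x : P × Q => posetTheta x.1 * posetTheta x.2) (fun x => ?_) x
  have hs : ∑ z : P × Q with x ≤ z, posetTheta z.1 * posetTheta z.2 =
      ∑ z ∈ (Finset.univ.filter fun z : P => x.1 ≤ z) ×ˢ (Finset.univ.filter fun z : Q => x.2 ≤ z),
        posetTheta z.1 * posetTheta z.2 := by
    refine Finset.sum_congr ?_ fun _ _ => rfl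
    ext z
    simp [Prod.le_def]
  have ht := hs.trans (Finset.sum_product _ _ _)
  rw [← Finset.sum_mul_sum, sum_posetTheta_ge, sum_posetTheta_ge, one_mul] at ht
  convert ht

theorem posetTheta_of_isMax {P : Type*} [PartialOrder P] [Finite P] {x : P} (hx : IsMax x) :
    posetTheta x = 1 := by
  classical
  let _ : Fintype P := Fintype.ofFinite P
  rw [← sum_posetTheta_ge x]
  have hs : (Finset.univ.filter fun z : P => x ≤ z) = {x} := by
    ext z
    simp only [Finset.mem_filter, Finset.mem_univ, true_and, Finset.mem_singleton]
    exact ⟨fun h => (hx.eq_of_le h).symm, fun h => h.ge⟩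
  rw [hs, Finset.sum_singleton]

/-! ### Splitting elements into parts of coprime orders -/

/-- By the Chinese remainder theorem, take s ≡ 1, t ≡ 0 mod a and s ≡ 0, t ≡ 1 mod b. The exponents
do not depend on the group, so the splitting is compatible with homomorphisms and with products of
commuting elements. -/
theorem exists_coprime_split {a b : ℕ} (hab : a.Coprime b) :
    ∃ s t : ℕ, ∀ {G : Type*} [Group G] (g : G),
      (g ^ (a * b) = 1 → g ^ s * g ^ t = g ∧ (g ^ s) ^ a = 1 ∧ (g ^ t) ^ b = 1) ∧
      (g ^ a = 1 → g ^ s = g ∧ g ^ t = 1) ∧ (g ^ b = 1 → g ^ s = 1 ∧ g ^ t = g) := by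
  obtain ⟨s, hs1, hs2⟩ := Nat.chineseRemainder hab 1 0
  obtain ⟨t, ht1, ht2⟩ := Nat.chineseRemainder hab 0 1
  have hbs : b ∣ s := (Nat.modEq_zero_iff_dvd).1 hs2
  have hat : a ∣ t := (Nat.modEq_zero_iff_dvd).1 ht1
  have key : ∀ {G : Type _} [Group G] (g : G) (k m n : ℕ), g ^ k = 1 → m ≡ n [MOD k] →
      g ^ m = g ^ n := fun g k m n hg hmn =>
    pow_eq_pow_iff_modEq.2 (hmn.of_dvd (orderOf_dvd_of_pow_eq_one hg))
  have key1 : ∀ {G : Type _} [Group G] (g : G) (k m : ℕ), g ^ k = 1 → k ∣ m → g ^ m = 1 :=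
    fun g k m hg hm => orderOf_dvd_iff_pow_eq_one.1 ((orderOf_dvd_of_pow_eq_one hg).trans hm)
  refine ⟨s, t, fun {G} _ g => ⟨fun hg => ⟨?_, ?_, ?_⟩, fun hg => ⟨?_, ?_⟩, fun hg => ⟨?_, ?_⟩⟩⟩
  · rw [← pow_add]
    conv_rhs => rw [← pow_one g]
    refine key g _ _ _ hg ((Nat.modEq_and_modEq_iff_modEq_mul hab).1 ⟨?_, ?_⟩)
    · simpa using hs1.add ht1
    · simpa using hs2.add ht2
  · rw [← pow_mul]
    exact key1 g _ _ hg (by rw [mul_comm]; exact mul_dvd_mul_right hbs a)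
  · rw [← pow_mul]
    exact key1 g _ _ hg (mul_dvd_mul_right hat b)
  · conv_rhs => rw [← pow_one g]
    exact key g _ _ _ hg hs1
  · exact key1 g _ _ hg hat
  · exact key1 g _ _ hg hbs
  · conv_rhs => rw [← pow_one g]
    exact key g _ _ _ hg ht2

theorem pow_ordProj_eq_one {G : Type*} [Group G] {p n : ℕ} (hp : p.Prime) (hn : n ≠ 0)
    {x : G} (hxn : x ^ n = 1) (hx : ∃ k, x ^ p ^ k = 1) : x ^ p ^ n.factorization p = 1 := by
  obtain ⟨k, hk⟩ := hx
  obtain ⟨j, _, hj⟩ := (Nat.dvd_prime_pow hp).1 (orderOf_dvd_of_pow_eq_one hk)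
  rw [← orderOf_dvd_iff_pow_eq_one, hj]
  exact pow_dvd_pow _ ((hp.pow_dvd_iff_le_factorization hn).1 (hj ▸ orderOf_dvd_of_pow_eq_one hxn))

theorem eq_one_of_pow_eq_one_of_coprime {G : Type*} [Group G] {a b : ℕ} (hab : a.Coprime b)
    {x : G} (ha : x ^ a = 1) (hb : x ^ b = 1) : x = 1 := by
  rw [← orderOf_eq_one_iff]
  exact Nat.eq_one_of_dvd_coprimes hab (orderOf_dvd_of_pow_eq_one ha) (orderOf_dvd_of_pow_eq_one hb)

/-! ### Counting p-elements -/

/-- The number of `p`-elements of a group. -/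
noncomputable def pElementCount (p : ℕ) (G : Type*) [Group G] : ℕ :=
  Nat.card {x : G // ∃ k, x ^ p ^ k = 1}

theorem pElementCount_congr (p : ℕ) {G H : Type*} [Group G] [Group H] (e : G ≃* H) :
    pElementCount p G = pElementCount p H := by
  refine Nat.card_congr (e.toEquiv.subtypeEquiv fun x => ?_)
  simp only [MulEquiv.toEquiv_eq_coe, EquivLike.coe_coe, ← map_pow, EmbeddingLike.map_eq_one_iff]

open Classical in
/-- Counting elements by their `p'`-parts. -/
theorem sum_pElementCount_centralizer {G : Type*} [Group G] [Fintype G] {p : ℕ} (hp : p.Prime) :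
    ∑ y : G with y ^ (Nat.card G / p ^ (Nat.card G).factorization p) = 1,
      pElementCount p (Subgroup.centralizer {y}) = Nat.card G := by
  set a := p ^ (Nat.card G).factorization p with ha
  set b := Nat.card G / a with hb
  have hab : a.Coprime b := (Nat.coprime_ordCompl hp Nat.card_pos.ne').pow_left _
  have hmul : a * b = Nat.card G := Nat.ordProj_mul_ordCompl_eq_self _ _
  obtain ⟨s, t, hst⟩ := exists_coprime_split hab
  have hG : ∀ g : G, g ^ (a * b) = 1 := fun g => by rw [hmul]; exact pow_card_eq_one'
  have h1 : Nat.card G = ∑ y : G with y ^ b = 1,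
      (Finset.univ.filter fun g : G => g ^ t = y).card := by
    rw [Nat.card_eq_fintype_card, ← Finset.card_univ]
    exact Finset.card_eq_sum_card_fiberwise fun g _ => by simpa using ((hst g).1 (hG g)).2.2
  rw [h1]
  refine Finset.sum_congr rfl fun y hy => ?_
  have hy : y ^ b = 1 := by simpa using hy
  rw [← Fintype.card_subtype, ← Nat.card_eq_fintype_card]
  -- The elements with p'-part y are the products x * y with x a p-element centralizing y; the
  -- p-part g ^ s recovers x.
  refine Nat.card_congr
    { toFun := fun x => ⟨x.1.1 * y, ?_⟩
      invFun := fun g => ⟨⟨g.1 ^ s, ?_⟩, ?_⟩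
      left_inv := ?_
      right_inv := ?_ }
  · obtain ⟨⟨x, hx⟩, k, hk⟩ := x
    have hc : Commute x y := (Subgroup.mem_centralizer_singleton_iff.1 hx)
    have hk' : x ^ p ^ k = 1 := by simpa using congrArg Subtype.val hk
    rw [hc.mul_pow, ((hst x).2.1 (pow_ordProj_eq_one hp Nat.card_pos.ne'
      pow_card_eq_one' ⟨k, hk'⟩)).2, ((hst y).2.2 hy).2, one_mul]
  · have h2 : Commute (g.1 ^ s) (g.1 ^ t) := Commute.pow_pow_self _ _ _
    rw [g.2] at h2
    exact Subgroup.mem_centralizer_singleton_iff.2 h2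
  · exact ⟨_, Subtype.ext ((hst g.1).1 (hG g.1)).2.1⟩
  · rintro ⟨⟨x, hx⟩, k, hk⟩
    have hc : Commute x y := (Subgroup.mem_centralizer_singleton_iff.1 hx)
    have hk' : x ^ p ^ k = 1 := by simpa using congrArg Subtype.val hk
    refine Subtype.ext (Subtype.ext ?_)
    change (x * y) ^ s = x
    rw [hc.mul_pow, ((hst x).2.1 (pow_ordProj_eq_one hp Nat.card_pos.ne'
      pow_card_eq_one' ⟨k, hk'⟩)).1, ((hst y).2.2 hy).1, mul_one]
  · rintro ⟨g, hg⟩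
    refine Subtype.ext ?_
    change g ^ s * y = g
    rw [← hg]
    exact ((hst g).1 (hG g)).1

/-- Orbit sums: an invariant function divisible by the `p`-parts of the stabilizers. -/
theorem ordProj_dvd_sum_of_stabilizer {G T : Type*} [Group G] [Finite G] [MulAction G T] [Fintype T]
    {p : ℕ} (h : T → ℤ) (hinv : ∀ (g : G) t, h (g • t) = h t)
    (hdvd : ∀ t, ((p ^ (Nat.card (MulAction.stabilizer G t)).factorization p : ℕ) : ℤ) ∣ h t) :
    ((p ^ (Nat.card G).factorization p : ℕ) : ℤ) ∣ ∑ t, h t := by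
  classical
  rw [← Finset.sum_fiberwise Finset.univ (Quotient.mk (MulAction.orbitRel G T))]
  refine Finset.dvd_sum fun ω _ => ?_
  obtain ⟨t₀, rfl⟩ := Quotient.exists_rep ω
  have horb : ∀ t, Quotient.mk (MulAction.orbitRel G T) t = Quotient.mk _ t₀ ↔
      t ∈ MulAction.orbit G t₀ := fun t => by
    rw [Quotient.eq]; exact MulAction.orbitRel_apply
  rw [Finset.sum_congr rfl (g := fun _ => h t₀)]
  · have hcard : (Finset.univ.filter fun t => Quotient.mk (MulAction.orbitRel G T) t =
        Quotient.mk _ t₀).card = Nat.card (MulAction.orbit G t₀) := by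
      rw [Nat.card_eq_fintype_card, ← Set.toFinset_card]
      congr 1
      ext t
      simp [horb]
    have hprod : Nat.card (MulAction.orbit G t₀) * Nat.card (MulAction.stabilizer G t₀) =
        Nat.card G := by
      rw [Nat.card_congr (MulAction.orbitEquivQuotientStabilizer G t₀),
        ← Subgroup.card_eq_card_quotient_mul_card_subgroup]
    rw [Finset.sum_const, hcard, nsmul_eq_mul]
    have : p ^ (Nat.card G).factorization p =
        p ^ (Nat.card (MulAction.orbit G t₀)).factorization p *
          p ^ (Nat.card (MulAction.stabilizer G t₀)).factorization p := by
      have h1 : Nat.card (MulAction.orbit G t₀) ≠ 0 := by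
        intro h0
        rw [h0, zero_mul] at hprod
        exact Nat.card_pos.ne hprod
      rw [← hprod, Nat.factorization_mul h1 Nat.card_pos.ne', Finsupp.add_apply, pow_add]
    rw [this, Nat.cast_mul]
    exact mul_dvd_mul (Int.natCast_dvd_natCast.2 (Nat.ordProj_dvd _ _)) (hdvd t₀)
  · intro t ht
    obtain ⟨g, rfl⟩ := (horb t).1 (by simpa using ht)
    exact hinv g t₀

theorem pElementCount_centralizer_conj (p : ℕ) {G : Type*} [Group G] (g y : G) :
    pElementCount p (Subgroup.centralizer {g * y * g⁻¹}) =
      pElementCount p (Subgroup.centralizer {y}) := by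
  have h : (Subgroup.centralizer {y}).map (MulAut.conj g).toMonoidHom =
      Subgroup.centralizer {g * y * g⁻¹} := by
    ext x
    rw [Subgroup.mem_map_equiv, Subgroup.mem_centralizer_singleton_iff,
      Subgroup.mem_centralizer_singleton_iff, MulAut.conj_symm_apply,
      ← mul_right_inj g, ← mul_left_inj g⁻¹]
    simp only [mul_assoc, mul_inv_cancel_left, mul_inv_cancel, mul_one]
  rw [← h]
  exact (pElementCount_congr p ((MulAut.conj g).subgroupMap _)).symm

/-- Frobenius' theorem for the number of `p`-elements. -/
theorem ordProj_dvd_pElementCount {p : ℕ} (hp : p.Prime) (G : Type*) [Group G] [Finite G] :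
    p ^ (Nat.card G).factorization p ∣ pElementCount p G := by
  classical
  induction hn : Nat.card G using Nat.strong_induction_on generalizing G with
  | _ n ih =>
  subst hn
  let _ : Fintype G := Fintype.ofFinite G
  set a := p ^ (Nat.card G).factorization p with ha
  set b := Nat.card G / a with hb
  have hab : a.Coprime b := (Nat.coprime_ordCompl hp Nat.card_pos.ne').pow_left _
  have hsum := sum_pElementCount_centralizer (G := G) hp
  rw [← ha, ← hb, ← Finset.sum_filter_add_sum_filter_not _ (fun y => y ∈ Subgroup.center G)] at hsum
  have hcen : ∀ y ∈ Subgroup.center G,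
      pElementCount p (Subgroup.centralizer {y}) = pElementCount p G := by
    intro y hy
    have : Subgroup.centralizer {y} = ⊤ :=
      Subgroup.centralizer_eq_top_iff_subset.2 (by simpa using hy)
    rw [this]
    exact pElementCount_congr p Subgroup.topEquiv
  rw [Finset.sum_congr rfl fun y hy => hcen y (Finset.mem_filter.1 hy).2, Finset.sum_const,
    smul_eq_mul] at hsum
  -- Noncentral y: sum over conjugacy classes, with induction applied to the proper subgroups C(y).
  have hnc : a ∣ ∑ y ∈ (Finset.univ.filter fun y : G => y ^ b = 1) with y ∉ Subgroup.center G,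
      pElementCount p (Subgroup.centralizer {y}) := by
    rw [Finset.filter_filter, Finset.sum_filter, ← Int.natCast_dvd_natCast, Nat.cast_sum]
    have hcc : Nat.card (ConjAct G) = Nat.card G := Nat.card_congr ConjAct.ofConjAct.toEquiv
    rw [ha, ← hcc]
    refine ordProj_dvd_sum_of_stabilizer (G := ConjAct G) _ ?_ ?_
    · intro g y
      have hpow : (g • y) ^ b = 1 ↔ y ^ b = 1 := by
        rw [← smul_pow', smul_eq_iff_eq_inv_smul, smul_one]
      have hmem : g • y ∈ Subgroup.center G ↔ y ∈ Subgroup.center G := by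
        rw [ConjAct.smul_def]
        exact (inferInstance : (Subgroup.center G).Normal).mem_comm_iff.trans (by simp)
      exact congrArg _ (if_ctx_congr (and_congr hpow (not_congr hmem))
        (fun _ => pElementCount_centralizer_conj p (ConjAct.ofConjAct g) y) fun _ => rfl)
    · intro y
      split_ifs with hy
      · have hst : Nat.card (MulAction.stabilizer (ConjAct G) y) =
            Nat.card (Subgroup.centralizer {y}) := by
          rw [ConjAct.stabilizer_eq_centralizer]
          rfl
        rw [hst, Int.natCast_dvd_natCast]
        refine ih _ ?_ _ rfl
        refine lt_of_le_of_ne (Subgroup.card_le_card_group _) fun h => hy.2 ?_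
        have := Subgroup.eq_top_of_card_eq _ h
        simpa using Subgroup.centralizer_eq_top_iff_subset.1 this
      · simp
  have h0 : a ∣ Nat.card G := Nat.ordProj_dvd _ _
  rw [← hsum] at h0
  have h1 := (Nat.dvd_add_left hnc).1 h0
  refine Nat.Coprime.dvd_of_dvd_mul_left ?_ h1
  refine (Nat.Prime.coprime_pow_of_not_dvd hp ?_).symm
  -- Each central y contributes `pElementCount p G`. Such y form a group of exponent dividing b, so
  -- by Cauchy their number is prime to p and can be cancelled.
  let Zb : Subgroup G :=
    { carrier := {y | y ∈ Subgroup.center G ∧ y ^ b = 1}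
      one_mem' := ⟨one_mem _, one_pow _⟩
      mul_mem' := fun {x y} hx hy => ⟨mul_mem hx.1 hy.1, by
        rw [Commute.mul_pow ((Subgroup.mem_center_iff.1 hy.1) x), hx.2, hy.2, one_mul]⟩
      inv_mem' := fun {x} hx => ⟨inv_mem hx.1, by rw [inv_pow, hx.2, inv_one]⟩ }
  have hZ : (Finset.filter (fun y => y ∈ Subgroup.center G)
      (Finset.univ.filter fun y : G => y ^ b = 1)).card = Nat.card Zb := by
    rw [Finset.filter_filter, ← Fintype.card_subtype, ← Nat.card_eq_fintype_card]
    exact Nat.card_congr (Equiv.subtypeEquivRight fun y => and_comm)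
  rw [hZ]
  intro hdvd
  have := Fact.mk hp
  obtain ⟨z, hz⟩ := exists_prime_orderOf_dvd_card' p hdvd
  have h2 : p ∣ b := by
    rw [← hz]
    exact orderOf_dvd_of_pow_eq_one (Subtype.ext z.2.2)
  exact Nat.not_dvd_ordCompl hp Nat.card_pos.ne' h2

theorem dvd_totient_of_forall_prime {m k : ℕ} (hk : k ≠ 1)
    (h : ∀ q, q.Prime → q ∣ k → m ∣ q - 1) : m ∣ k.totient := by
  obtain ⟨q, hq, hqk⟩ := Nat.exists_prime_and_dvd hk
  have := Nat.totient_dvd_of_dvd hqk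
  rw [Nat.totient_prime hq] at this
  exact (h q hq hqk).trans this

open Classical in
theorem card_filter_zpowers_eq {G : Type*} [Group G] [Fintype G] (y : G) :
    (Finset.univ.filter fun x : G => Subgroup.zpowers x = Subgroup.zpowers y).card =
      (orderOf y).totient := by
  have h := IsCyclic.card_orderOf_eq_totient (α := Subgroup.zpowers y) (d := orderOf y)
    (by rw [← Nat.card_eq_fintype_card, Nat.card_zpowers])
  rw [← h]
  symm
  refine Finset.card_bij (fun x _ => x.1) ?_ (fun _ _ _ _ => Subtype.ext) ?_
  · intro x hx
    simp only [Finset.mem_filter, Finset.mem_univ, true_and] at hx ⊢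
    refine Subgroup.eq_of_le_of_card_ge (by simp) ?_
    rw [Nat.card_zpowers, Nat.card_zpowers, Subgroup.orderOf_coe, hx]
  · intro x hx
    simp only [Finset.mem_filter, Finset.mem_univ, true_and] at hx
    refine ⟨⟨x, hx ▸ Subgroup.mem_zpowers x⟩, ?_, rfl⟩
    simp only [Finset.mem_filter, Finset.mem_univ, true_and, Subgroup.orderOf_mk]
    rw [← Nat.card_zpowers, hx, Nat.card_zpowers]

/-- Group the p'-elements y by the cyclic subgroup they generate. Generators of the same subgroup
have the same centralizer, and for y ≠ 1 their number φ(|y|) is a multiple of m. Modulo m only y = 1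
survives. -/
theorem pElementCount_modEq {p m : ℕ} (hp : p.Prime) {G : Type*} [Group G] [Finite G]
    (hm : ∀ q, q.Prime → q ≠ p → q ∣ Nat.card G → m ∣ q - 1) :
    pElementCount p G ≡ Nat.card G [MOD m] := by
  classical
  let _ : Fintype G := Fintype.ofFinite G
  have hsum := sum_pElementCount_centralizer (G := G) hp
  set b := Nat.card G / p ^ (Nat.card G).factorization p with hb
  have hone : pElementCount p (Subgroup.centralizer {(1 : G)}) = pElementCount p G := by
    have : Subgroup.centralizer {(1 : G)} = ⊤ :=
      Subgroup.centralizer_eq_top_iff_subset.2 (by simp [one_mem])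
    rw [this]
    exact pElementCount_congr p Subgroup.topEquiv
  have hrest : m ∣ ∑ y ∈ (Finset.univ.filter fun y : G => y ^ b = 1).erase 1,
      pElementCount p (Subgroup.centralizer {y}) := by
    rw [← Finset.sum_fiberwise _ Subgroup.zpowers]
    refine Finset.dvd_sum fun K _ => ?_
    by_cases hK : ∃ y : G, y ≠ 1 ∧ y ^ b = 1 ∧ Subgroup.zpowers y = K
    · obtain ⟨y, hy1, hyb, rfl⟩ := hK
      have hset : (((Finset.univ.filter fun y : G => y ^ b = 1).erase 1).filter fun x =>
          Subgroup.zpowers x = Subgroup.zpowers y) =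
          Finset.univ.filter fun x => Subgroup.zpowers x = Subgroup.zpowers y := by
        ext x
        simp only [Finset.mem_filter, Finset.mem_erase, Finset.mem_univ, true_and,
          and_iff_right_iff_imp]
        intro hx
        have ho : orderOf x = orderOf y := by rw [← Nat.card_zpowers, hx, Nat.card_zpowers]
        refine ⟨fun h => hy1 (by rw [← orderOf_eq_one_iff, ← ho, h, orderOf_one]), ?_⟩
        rw [← orderOf_dvd_iff_pow_eq_one, ho]
        exact orderOf_dvd_of_pow_eq_one hyb
      have hc : ∀ x : G, Subgroup.zpowers x = Subgroup.zpowers y →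
          Subgroup.centralizer {x} = Subgroup.centralizer {y} := fun x hx => by
        rw [← Subgroup.centralizer_closure {x}, ← Subgroup.centralizer_closure {y},
          ← Subgroup.zpowers_eq_closure, ← Subgroup.zpowers_eq_closure, hx]
      rw [hset, Finset.sum_congr rfl fun x hx => by rw [hc x (Finset.mem_filter.1 hx).2],
        Finset.sum_const, card_filter_zpowers_eq, smul_eq_mul]
      refine Dvd.dvd.mul_right (dvd_totient_of_forall_prime (by simpa using hy1) ?_) _
      intro q hq hqy
      have hqb : q ∣ b := hqy.trans (orderOf_dvd_of_pow_eq_one hyb)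
      refine hm q hq ?_ (hqb.trans (Nat.ordCompl_dvd _ _))
      rintro rfl
      exact Nat.not_dvd_ordCompl hp Nat.card_pos.ne' hqb
    · rw [Finset.sum_eq_zero]
      · exact dvd_zero _
      · intro x hx
        simp only [Finset.mem_filter, Finset.mem_erase, Finset.mem_univ, true_and] at hx
        exact (hK ⟨x, hx.1.1, hx.1.2, hx.2⟩).elim
  rw [← Finset.add_sum_erase _ _ (a := (1 : G)) (by simp), hone] at hsum
  rw [← hsum]
  simpa using (Nat.ModEq.refl (pElementCount p G)).add (Nat.modEq_zero_iff_dvd.2 hrest).symm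

/-! ### The poset of p-subgroups and divisibility of θ(1) -/

/-- The poset of `p`-subgroups of a group. -/
abbrev PSubgroup (p : ℕ) (G : Type*) [Group G] : Type _ := {A : Subgroup G // IsPGroup p A}

namespace PSubgroup

variable {p : ℕ} {G H : Type*} [Group G] [Group H]

/-- The trivial `p`-subgroup. -/
def bot (p : ℕ) (G : Type*) [Group G] : PSubgroup p G := ⟨⊥, IsPGroup.of_bot⟩

/-- The image of a `p`-subgroup. -/
def map (φ : G →* H) (A : PSubgroup p G) : PSubgroup p H := ⟨A.1.map φ, A.2.map φ⟩

/-- The preimage of a `p`-subgroup under a homomorphism whose kernel is a `p`-group. -/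
def comap (φ : G →* H) (hφ : IsPGroup p φ.ker) (A : PSubgroup p H) : PSubgroup p G :=
  ⟨A.1.comap φ, A.2.comap_of_ker_isPGroup φ hφ⟩

theorem map_le_iff_le_comap (φ : G →* H) (hφ : IsPGroup p φ.ker) (A : PSubgroup p G)
    (B : PSubgroup p H) : A.map φ ≤ B ↔ A ≤ B.comap φ hφ :=
  Subgroup.map_le_iff_le_comap

theorem posetTheta_map_equiv [Finite G] [Finite H] (e : G ≃* H) (A : PSubgroup p G) :
    posetTheta (A.map e.toMonoidHom) = posetTheta A := by
  refine posetTheta_eq_of_galois (j := map e.symm.toMonoidHom) (f := map e.toMonoidHom)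
    (fun q a => ?_) fun a => ?_
  · change q.1.map e.symm.toMonoidHom ≤ a.1 ↔ q.1 ≤ a.1.map e.toMonoidHom
    rw [Subgroup.map_le_iff_le_comap]
    exact iff_of_eq (congrArg (q.1 ≤ ·) (Subgroup.map_equiv_eq_comap_symm e a.1).symm)
  · refine ⟨fun h => Subtype.ext ?_, fun h => h ▸ rfl⟩
    exact Subgroup.map_injective e.injective (congrArg Subtype.val h)

theorem posetTheta_quotient [Finite G] (L : PSubgroup p G) [L.1.Normal] :
    posetTheta L = posetTheta (bot p (G ⧸ L.1)) := by
  have hker : IsPGroup p (QuotientGroup.mk' L.1).ker := by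
    rw [QuotientGroup.ker_mk']
    exact L.2
  refine posetTheta_eq_of_galois (j := map (QuotientGroup.mk' L.1))
    (f := comap (QuotientGroup.mk' L.1) hker)
    (fun q a => map_le_iff_le_comap _ _ _ _) fun a => ?_
  rw [Subtype.ext_iff, Subtype.ext_iff]
  change a.1.comap _ = L.1 ↔ a.1 = ⊥
  have hL : (⊥ : Subgroup (G ⧸ L.1)).comap (QuotientGroup.mk' L.1) = L.1 := by
    rw [MonoidHom.comap_bot, QuotientGroup.ker_mk']
  conv_lhs => rhs; rw [← hL]
  exact (Subgroup.comap_injective (QuotientGroup.mk'_surjective L.1)).eq_iff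

/-- Normalizers grow in the nilpotent group B. -/
theorem eq_of_inf_normalizer_eq [Finite G] [Fact p.Prime] {A B : Subgroup G} (hB : IsPGroup p B)
    (h : B ⊓ Subgroup.normalizer (A : Set G) = A) : B = A := by
  have hAB : A ≤ B := h ▸ inf_le_left
  by_contra hne
  have hnil : Group.IsNilpotent B := hB.isNilpotent
  have hlt : A.subgroupOf B < ⊤ :=
    lt_top_iff_ne_top.2 fun ht => hne (le_antisymm (Subgroup.subgroupOf_eq_top.1 ht) hAB)
  obtain ⟨x, hx, hxA⟩ := SetLike.exists_of_lt (Group.normalizerCondition_of_isNilpotent _ hlt)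
  refine hxA ?_
  have hxN : (x : G) ∈ Subgroup.normalizer (A : Set G) := by
    rw [Subgroup.mem_normalizer_iff] at hx ⊢
    intro y
    by_cases hy : y ∈ B
    · exact hx ⟨y, hy⟩
    · refine ⟨fun h => (hy (hAB h)).elim, fun h => (hy ?_).elim⟩
      have := B.mul_mem (B.mul_mem (B.inv_mem x.2) (hAB h)) x.2
      simpa [mul_assoc] using this
  have : (x : G) ∈ B ⊓ Subgroup.normalizer (A : Set G) := ⟨x.2, hxN⟩
  rw [h] at this
  exact this

/-- Intersection with N(A) is right adjoint to inclusion, and by normalizer growth only A itself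
meets N(A) in A. This reduces to A normal, where the quotient applies. -/
theorem posetTheta_normalizer [Finite G] [Fact p.Prime] (A : PSubgroup p G) :
    posetTheta A = posetTheta (bot p (Subgroup.normalizer (A.1 : Set G) ⧸
      A.1.subgroupOf (Subgroup.normalizer (A.1 : Set G)))) := by
  set N := Subgroup.normalizer (A.1 : Set G) with hN
  have hker : IsPGroup p N.subtype.ker := by
    rw [Subgroup.ker_subtype]
    exact IsPGroup.of_bot
  let L : PSubgroup p N := A.comap N.subtype hker
  have : L.1.Normal := Subgroup.normal_in_normalizer
  refine Eq.trans ?_ (posetTheta_quotient L)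
  refine (posetTheta_eq_of_galois (j := map N.subtype) (f := comap N.subtype hker)
    (fun q a => map_le_iff_le_comap _ _ _ _) fun a => ?_).symm
  refine ⟨fun h => Subtype.ext (eq_of_inf_normalizer_eq a.2 ?_), fun h => h ▸ rfl⟩
  have h1 : a.1.subgroupOf N = A.1.subgroupOf N := congrArg Subtype.val h
  rw [Subgroup.subgroupOf_inj] at h1
  rw [← hN, h1]
  exact inf_eq_left.2 Subgroup.le_normalizer

-- Count pairs x ∈ A weighted by θ(A): for a p-element x, the A containing x are those above ⟨x⟩,
-- whose θ-values sum to 1.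
open Classical in
theorem sum_card_mul_posetTheta [Fintype (PSubgroup p G)] [Finite G] :
    ∑ A : PSubgroup p G, (Nat.card A.1 : ℤ) * posetTheta A = pElementCount p G := by
  let _ : Fintype G := Fintype.ofFinite G
  have h1 : ∀ A : PSubgroup p G, (Nat.card A.1 : ℤ) * posetTheta A =
      ∑ x : G, if x ∈ A.1 then posetTheta A else 0 := fun A => by
    rw [← Finset.sum_filter, Finset.sum_const, nsmul_eq_mul, ← Fintype.card_subtype,
      ← Nat.card_eq_fintype_card]
  rw [Finset.sum_congr rfl fun A _ => h1 A, Finset.sum_comm, pElementCount,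
    Nat.card_eq_fintype_card, Fintype.card_subtype, Finset.card_eq_sum_ones, Nat.cast_sum,
    Finset.sum_filter]
  refine Finset.sum_congr rfl fun x _ => ?_
  split_ifs with hx
  · obtain ⟨k, hk⟩ := hx
    have hz : IsPGroup p (Subgroup.zpowers x) := by
      rintro ⟨_, j, rfl⟩
      refine ⟨k, Subtype.ext ?_⟩
      change (x ^ j) ^ p ^ k = 1
      rw [← zpow_natCast, zpow_comm, zpow_natCast, hk, one_zpow]
    rw [Nat.cast_one, ← sum_posetTheta_ge (⟨_, hz⟩ : PSubgroup p G), Finset.sum_filter]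
    refine Finset.sum_congr rfl fun A _ => if_congr ?_ rfl rfl
    exact Subgroup.zpowers_le.symm
  · refine Finset.sum_eq_zero fun A _ => if_neg fun hxA => hx ?_
    obtain ⟨k, hk⟩ := A.2 ⟨x, hxA⟩
    exact ⟨k, congrArg Subtype.val hk⟩

end PSubgroup

namespace PSubgroup

theorem card_normalizer_quotient {G : Type*} [Group G] (A : Subgroup G) :
    Nat.card (Subgroup.normalizer (A : Set G)) =
      Nat.card (Subgroup.normalizer (A : Set G) ⧸
        A.subgroupOf (Subgroup.normalizer (A : Set G))) * Nat.card A := by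
  rw [Subgroup.card_eq_card_quotient_mul_card_subgroup
    (A.subgroupOf (Subgroup.normalizer (A : Set G))),
    Nat.card_congr (Subgroup.subgroupOfEquivOfLe A.le_normalizer).toEquiv]

theorem card_normalizer_quotient_lt {G : Type*} [Group G] [Finite G] {A : Subgroup G}
    (hA : A ≠ ⊥) :
    Nat.card (Subgroup.normalizer (A : Set G) ⧸
      A.subgroupOf (Subgroup.normalizer (A : Set G))) < Nat.card G := by
  refine lt_of_lt_of_le ?_ (Subgroup.card_le_card_group (Subgroup.normalizer (A : Set G)))
  conv_rhs => rw [card_normalizer_quotient A]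
  exact lt_mul_of_one_lt_right Nat.card_pos ((Subgroup.one_lt_card_iff_ne_bot A).2 hA)

/-- Brown's theorem for the poset of `p`-subgroups. -/
theorem ordProj_dvd_posetTheta_bot {p : ℕ} (hp : p.Prime) (G : Type*) [Group G] [Finite G] :
    ((p ^ (Nat.card G).factorization p : ℕ) : ℤ) ∣ posetTheta (bot p G) := by
  classical
  have := Fact.mk hp
  induction hn : Nat.card G using Nat.strong_induction_on generalizing G with
  | _ n ih =>
  subst hn
  let _ : Fintype (PSubgroup p G) := Fintype.ofFinite _
  have hsum := sum_card_mul_posetTheta (p := p) (G := G)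
  have hdvd := Int.natCast_dvd_natCast.2 (ordProj_dvd_pElementCount hp G)
  rw [← hsum, ← Finset.add_sum_erase _ _ (Finset.mem_univ (bot p G))] at hdvd
  have hbot : Nat.card (bot p G).1 = 1 := Subgroup.card_bot
  rw [hbot, Nat.cast_one, one_mul] at hdvd
  refine (Int.dvd_add_left ?_).1 hdvd
  let _ : MulAction G (PSubgroup p G) :=
    { smul := fun g A => A.map (MulAut.conj g).toMonoidHom
      one_smul := fun A => Subtype.ext <| by
        change A.1.map (MulAut.conj 1).toMonoidHom = A.1
        rw [map_one]
        exact Subgroup.map_id _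
      mul_smul := fun g h A => Subtype.ext <| by
        change A.1.map (MulAut.conj (g * h)).toMonoidHom =
          (A.1.map (MulAut.conj h).toMonoidHom).map (MulAut.conj g).toMonoidHom
        rw [Subgroup.map_map, map_mul]
        rfl }
  have hsm : ∀ (g : G) (A : PSubgroup p G), g • A = A.map (MulAut.conj g).toMonoidHom :=
    fun _ _ => rfl
  have hcard : ∀ (g : G) (A : PSubgroup p G), Nat.card (g • A).1 = Nat.card A.1 := fun g A =>
    Subgroup.card_map_of_injective (MulAut.conj g).injective
  rw [← Finset.filter_ne', Finset.sum_filter]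
  refine ordProj_dvd_sum_of_stabilizer (G := G) _ (fun g A => ?_) fun A => ?_
  · have h1 : g • A ≠ bot p G ↔ A ≠ bot p G := by
      rw [ne_eq, ne_eq, Subtype.ext_iff, Subtype.ext_iff]
      change ¬ (g • A).1 = ⊥ ↔ ¬ A.1 = ⊥
      rw [← Subgroup.card_eq_one (H := A.1), ← hcard g A, Subgroup.card_eq_one]
    rw [hcard, if_congr h1 rfl rfl, hsm, posetTheta_map_equiv]
  · split_ifs with hA
    · have hstab : MulAction.stabilizer G A = Subgroup.normalizer (A.1 : Set G) := by
        ext g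
        rw [MulAction.mem_stabilizer_iff, Subgroup.mem_normalizer_iff, hsm, Subtype.ext_iff]
        change A.1.map (MulAut.conj g).toMonoidHom = A.1 ↔ _
        rw [SetLike.ext_iff]
        constructor
        · intro h y
          rw [← h (g * y * g⁻¹)]
          exact (Subgroup.mem_map_iff_mem (MulAut.conj g).injective).symm
        · intro h y
          rw [Subgroup.mem_map_equiv, MulAut.conj_symm_apply, h]
          simp [mul_assoc]
      have hA' : A.1 ≠ ⊥ := fun h => hA (Subtype.ext h)
      obtain ⟨k, hk⟩ := A.2.exists_card_eq
      -- The p-part of |N(A)| is split between N(A)/A, covered by induction, and the weight |A|.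
      have h2 := ih _ (card_normalizer_quotient_lt hA') _ rfl
      rw [← posetTheta_normalizer A] at h2
      rw [hstab, card_normalizer_quotient A.1, Nat.factorization_mul Nat.card_pos.ne'
        Nat.card_pos.ne', Finsupp.add_apply, pow_add, mul_comm, Nat.cast_mul]
      refine mul_dvd_mul (Int.natCast_dvd_natCast.2 ?_) h2
      exact Nat.ordProj_dvd _ _
    · exact dvd_zero _

theorem modEq_one_of_forall_prime {m d : ℕ} (hd : d ≠ 0)
    (h : ∀ q, q.Prime → q ∣ d → m ∣ q - 1) : d ≡ 1 [MOD m] := by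
  induction d using Nat.recOnMul with
  | zero => exact (hd rfl).elim
  | one => rfl
  | prime q hq => exact ((Nat.modEq_iff_dvd' hq.one_le).2 (h q hq dvd_rfl)).symm
  | mul a b ha hb =>
    have ha0 : a ≠ 0 := left_ne_zero_of_mul hd
    have hb0 : b ≠ 0 := right_ne_zero_of_mul hd
    simpa using (ha ha0 fun q hq hqa => h q hq (hqa.mul_right _)).mul
      (hb hb0 fun q hq hqb => h q hq (hqb.mul_left _))

open Classical in
theorem card_filter_card_eq {p : ℕ} [Fact p.Prime] {G : Type*} [Group G] [Finite G]
    [Fintype (PSubgroup p G)] :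
    (Finset.univ.filter fun A : PSubgroup p G =>
      Nat.card A.1 = p ^ (Nat.card G).factorization p).card = Nat.card (Sylow p G) := by
  rw [← Fintype.card_subtype, ← Nat.card_eq_fintype_card]
  refine Nat.card_congr
    { toFun := fun A => Sylow.ofCard A.1.1 A.2
      invFun := fun P => ⟨⟨P.1, P.2⟩, P.card_eq_multiplicity⟩
      left_inv := fun A => rfl
      right_inv := fun P => Sylow.ext rfl }

/-- Modulo m, the weighted sum loses all nontrivial non-Sylow terms by induction. The Sylow terms
have θ = 1 and add up to p ^ v, since the number of Sylow subgroups is 1 mod m. The total is also p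
^ v mod m, so θ(1) vanishes. -/
theorem dvd_posetTheta_bot {p m : ℕ} (hp : p.Prime) (G : Type*) [Group G] [Finite G]
    (hpG : p ∣ Nat.card G)
    (hm : ∀ q, q.Prime → q ≠ p → q ∣ Nat.card G → m ∣ q - 1) :
    (m : ℤ) ∣ posetTheta (bot p G) := by
  classical
  have := Fact.mk hp
  induction hn : Nat.card G using Nat.strong_induction_on generalizing G with
  | _ n ih =>
  subst hn
  let _ : Fintype (PSubgroup p G) := Fintype.ofFinite _
  have hsum := sum_card_mul_posetTheta (p := p) (G := G)
  set v := (Nat.card G).factorization p with hv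
  have hv0 : p ^ v ≠ 1 := by
    have : 0 < v := hp.factorization_pos_of_dvd Nat.card_pos.ne' hpG
    exact (Nat.one_lt_pow this.ne' hp.one_lt).ne'
  have hbot : Nat.card (bot p G).1 = 1 := Subgroup.card_bot
  have hterm : ∀ A ∈ Finset.univ.erase (bot p G), (Nat.card A.1 : ℤ) * posetTheta A ≡
      (if Nat.card A.1 = p ^ v then (p ^ v : ℕ) else 0 : ℤ) [ZMOD m] := by
    intro A hA
    have hA' : A.1 ≠ ⊥ := fun h => (Finset.mem_erase.1 hA).1 (Subtype.ext h)
    split_ifs with hc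
    · have hmax : IsMax A := fun B hB =>
        ((Sylow.ofCard A.1 hc).3 B.2 hB).le
      rw [posetTheta_of_isMax hmax, hc, mul_one]
    · refine Int.modEq_zero_iff_dvd.2 (Dvd.dvd.mul_left ?_ _)
      obtain ⟨k, hk⟩ := A.2.exists_card_eq
      -- A is not Sylow, so p still divides |N(A)/A|, as the induction hypothesis requires.
      have hkv : p ^ (k + 1) ∣ Nat.card G := by
        rw [hp.pow_dvd_iff_le_factorization Nat.card_pos.ne']
        have hle : k ≤ v := by
          rw [hv, ← hp.pow_dvd_iff_le_factorization Nat.card_pos.ne', ← hk]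
          exact Subgroup.card_subgroup_dvd_card _
        refine Nat.lt_of_le_of_ne hle fun h => hc ?_
        rw [hk, h]
      rw [posetTheta_normalizer A]
      refine ih _ (card_normalizer_quotient_lt hA') _
        (Sylow.prime_dvd_card_quotient_normalizer hkv hk) (fun q hq hqp hqd => ?_) rfl
      refine hm q hq hqp (hqd.trans ?_)
      exact (Dvd.intro _ (card_normalizer_quotient A.1).symm).trans
        (Subgroup.card_subgroup_dvd_card _)
  have hright : ∑ A ∈ Finset.univ.erase (bot p G),
      (if Nat.card A.1 = p ^ v then (p ^ v : ℕ) else 0 : ℤ) = Nat.card (Sylow p G) * (p ^ v : ℕ) := by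
    rw [← card_filter_card_eq, ← Finset.sum_filter, Finset.sum_const, nsmul_eq_mul]
    congr 3
    ext A
    simp only [Finset.mem_filter, Finset.mem_erase, Finset.mem_univ, and_true, true_and]
    refine and_iff_right_of_imp ?_
    rintro h rfl
    -- Since p divides |G|, the trivial subgroup is not Sylow.
    exact hv0 (h.symm.trans hbot)
  rw [← Finset.add_sum_erase _ _ (Finset.mem_univ (bot p G)), hbot, Nat.cast_one, one_mul] at hsum
  have hrest := Int.ModEq.sum hterm
  rw [hright] at hrest
  obtain ⟨P⟩ : Nonempty (Sylow p G) := inferInstance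
  have hPi : ∀ q, q.Prime → q ∣ P.1.index → m ∣ q - 1 := fun q hq hqi => by
    refine hm q hq ?_ (hqi.trans P.1.index_dvd_card)
    rintro rfl
    exact P.not_dvd_index hqi
  have hsyl : Nat.card (Sylow p G) ≡ 1 [MOD m] :=
    modEq_one_of_forall_prime Nat.card_pos.ne' fun q hq hqd => hPi q hq (hqd.trans P.card_dvd_index)
  have hidx : P.1.index ≡ 1 [MOD m] :=
    modEq_one_of_forall_prime Subgroup.index_ne_zero_of_finite hPi
  have hu : pElementCount p G ≡ p ^ v [MOD m] := by
    refine (pElementCount_modEq hp hm).trans ?_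
    rw [← P.1.index_mul_card, P.card_eq_multiplicity]
    simpa using hidx.mul_right (p ^ v)
  have hs' : (Nat.card (Sylow p G) : ℤ) * (p ^ v : ℕ) ≡ (p ^ v : ℕ) [ZMOD m] := by
    have := Int.natCast_modEq_iff.2 (hsyl.mul_right (p ^ v))
    simpa using this
  have hu' := Int.natCast_modEq_iff.2 hu
  rw [← hsum] at hu'
  refine Int.modEq_zero_iff_dvd.1 ?_
  have := hu'.sub (hrest.trans hs')
  simpa using this

end PSubgroup

/-! ### Subgroups determined prime by prime -/

/-- If q divided the index of H ∩ ⟨y⟩ in ⟨y⟩, a Sylow q-subgroup of ⟨y⟩, which lies in H, would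
contradict it. -/
theorem mem_of_forall_prime_part {G : Type*} [Group G] [Finite G] {H : Subgroup G} {y : G}
    (h : ∀ q : ℕ, q.Prime → ∀ x ∈ Subgroup.zpowers y, (∃ k, x ^ q ^ k = 1) → x ∈ H) : y ∈ H := by
  rw [← Subgroup.zpowers_le, ← Subgroup.relIndex_eq_one]
  by_contra hne
  obtain ⟨q, hq, hqd⟩ := Nat.exists_prime_and_dvd hne
  have := Fact.mk hq
  obtain ⟨P⟩ : Nonempty (Sylow q (Subgroup.zpowers y)) := inferInstance
  refine P.not_dvd_index (hqd.trans (Subgroup.index_dvd_of_le ?_))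
  intro x hx
  obtain ⟨k, hk⟩ := P.2 ⟨x, hx⟩
  refine h q hq x x.2 ⟨k, ?_⟩
  have := congrArg Subtype.val hk
  exact congrArg Subtype.val this

theorem exists_prime_split {p : ℕ} (hp : p.Prime) (n : ℕ) (hn : n ≠ 0) :
    ∃ s t : ℕ, ∀ {G : Type*} [Group G] (g : G), g ^ n = 1 →
      g ^ s * g ^ t = g ∧ (g ^ s) ^ p ^ n.factorization p = 1 ∧
        (g ^ t) ^ (n / p ^ n.factorization p) = 1 := by
  obtain ⟨s, t, hst⟩ := exists_coprime_split
    ((Nat.coprime_ordCompl hp hn).pow_left (n.factorization p))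
  refine ⟨s, t, fun g hg => (hst g).1 ?_⟩
  rwa [Nat.ordProj_mul_ordCompl_eq_self]

/-- Subgroups all of whose elements of prime power order `q ^ k` lie in `C q`. -/
def primewiseIn {G : Type*} [Group G] (C : ℕ → Subgroup G) : Set (Subgroup G) :=
  {K | ∀ q : ℕ, q.Prime → ∀ x ∈ K, (∃ k, x ^ q ^ k = 1) → x ∈ C q}

namespace primewiseIn

variable {G : Type*} [Group G] {C D : ℕ → Subgroup G}

theorem bot_mem : (⊥ : Subgroup G) ∈ primewiseIn C := fun q _ x hx _ => by
  rw [Subgroup.mem_bot.1 hx]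
  exact one_mem _

theorem mono {K L : Subgroup G} (hL : L ∈ primewiseIn C) (h : K ≤ L) : K ∈ primewiseIn C :=
  fun q hq x hx => hL q hq x (h hx)

/-- Elements of A ⊔ B are commuting products ab. If (ab) ^ q ^ k = 1, then a ^ q ^ k lies in C p ⊓ D
p = 1, so a and b are both q-elements, and a = 1 unless q = p. -/
theorem sup_mem (hdisj : ∀ p : ℕ, p.Prime → C p ⊓ D p = ⊥)
    (hcomm : ∀ p : ℕ, p.Prime → ∀ c ∈ C p, ∀ d ∈ D p, Commute c d)
    {p : ℕ} (hp : p.Prime) {A B : Subgroup G} (hA : IsPGroup p A) (hAC : A ≤ C p)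
    (hB : B ∈ primewiseIn C) (hBD : B ≤ D p) : A ⊔ B ∈ primewiseIn C := by
  intro q hq x hx ⟨k, hk⟩
  have hnorm : A ≤ Subgroup.normalizer (B : Set G) := fun a ha => by
    rw [Subgroup.mem_normalizer_iff'']
    intro b
    refine ⟨fun hb => ?_, fun hb => ?_⟩
    · rwa [mul_assoc, ← (hcomm p hp a (hAC ha) b (hBD hb)).eq, inv_mul_cancel_left]
    · have := (hcomm p hp a (hAC ha) _ (hBD hb)).eq
      rw [mul_assoc, mul_inv_cancel_left, mul_left_inj] at this
      rw [mul_assoc] at hb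
      rw [this]
      simpa [mul_assoc] using hb
  rw [← SetLike.mem_coe, Subgroup.coe_mul_of_left_le_normalizer_right A B hnorm] at hx
  obtain ⟨a, ha, b, hb, rfl⟩ := hx
  have hab := hcomm p hp a (hAC ha) b (hBD hb)
  rw [hab.mul_pow] at hk
  have haq : a ^ q ^ k = 1 := by
    rw [← Subgroup.mem_bot, ← hdisj p hp]
    refine ⟨(C p).pow_mem (hAC ha) _, ?_⟩
    rw [eq_inv_of_mul_eq_one_left hk]
    exact (D p).inv_mem ((D p).pow_mem (hBD hb) _)
  rw [haq, one_mul] at hk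
  have hbC : b ∈ C q := hB q hq b hb ⟨k, hk⟩
  refine mul_mem ?_ hbC
  by_cases hpq : p = q
  · exact hpq ▸ hAC ha
  · obtain ⟨j, hj⟩ := hA ⟨a, ha⟩
    have hj' : a ^ p ^ j = 1 := congrArg Subtype.val hj
    have : a = 1 := by
      rw [← orderOf_eq_one_iff]
      exact Nat.eq_one_of_dvd_coprimes (Nat.coprime_pow_primes j k hp hq hpq)
        (orderOf_dvd_of_pow_eq_one hj') (orderOf_dvd_of_pow_eq_one haq)
    rw [this]
    exact one_mem _

variable [Finite G]

theorem mem_D (hle : ∀ p q : ℕ, p.Prime → q.Prime → p ≠ q → C q ≤ D p)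
    {K : Subgroup G} (hK : K ∈ primewiseIn C) {p b : ℕ} (hp : p.Prime) (hb : p.Coprime b)
    {y : G} (hy : y ∈ K) (hyb : y ^ b = 1) : y ∈ D p := by
  refine mem_of_forall_prime_part fun q hq x hx hxq => ?_
  by_cases hpq : p = q
  · subst hpq
    obtain ⟨k, hk⟩ := hxq
    obtain ⟨j, rfl⟩ := hx
    have hxb : (y ^ j) ^ b = 1 := by
      rw [← zpow_natCast, zpow_comm, zpow_natCast, hyb, one_zpow]
    have : y ^ j = 1 := 
      eq_one_of_pow_eq_one_of_coprime (hb.pow_left k) hk hxb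
    change y ^ j ∈ D p
    rw [this]
    exact one_mem _
  · exact hle p q hp hq hpq (hK q hq x ((Subgroup.zpowers_le.2 hy) hx) hxq)

theorem exists_split (hle : ∀ p q : ℕ, p.Prime → q.Prime → p ≠ q → C q ≤ D p)
    {K : Subgroup G} (hK : K ∈ primewiseIn C) {p : ℕ} (hp : p.Prime) {x : G} (hx : x ∈ K) :
    ∃ s t : ℕ, x ^ s * x ^ t = x ∧ (∃ k, (x ^ s) ^ p ^ k = 1) ∧ x ^ s ∈ C p ∧ x ^ t ∈ D p := by
  obtain ⟨s, t, hst⟩ := exists_prime_split hp (Nat.card G) Nat.card_pos.ne'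
  obtain ⟨h1, h2, h3⟩ := hst x pow_card_eq_one'
  exact ⟨s, t, h1, ⟨_, h2⟩, hK p hp _ (K.pow_mem hx _) ⟨_, h2⟩,
    mem_D hle hK hp (Nat.coprime_ordCompl hp Nat.card_pos.ne') (K.pow_mem hx _) h3⟩

theorem isPGroup_inf (hle : ∀ p q : ℕ, p.Prime → q.Prime → p ≠ q → C q ≤ D p)
    (hdisj : ∀ p : ℕ, p.Prime → C p ⊓ D p = ⊥)
    {K : Subgroup G} (hK : K ∈ primewiseIn C) {p : ℕ} (hp : p.Prime) :
    IsPGroup p (K ⊓ C p : Subgroup G) := by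
  rintro ⟨x, hx, hxC⟩
  obtain ⟨s, t, h1, ⟨k, hk⟩, -, hD⟩ := exists_split hle hK hp hx
  have h0 : x ^ t = 1 := by
    rw [← Subgroup.mem_bot, ← hdisj p hp]
    exact ⟨(C p).pow_mem hxC _, hD⟩
  rw [h0, mul_one] at h1
  rw [h1] at hk
  exact ⟨k, Subtype.ext hk⟩

/-- The trivial subgroup as an element of `primewiseIn C`. -/
def bot (C : ℕ → Subgroup G) : primewiseIn C := ⟨⊥, bot_mem⟩

/-- K ↦ (K ⊓ C p, K ⊓ D p) is right adjoint to (A, B) ↦ A ⊔ B. Only K = 1 goes to the bottom pair,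
because each element of K splits into its p-part in C p and its p'-part in D p. Then θ is
multiplicative on the product. -/
theorem posetTheta_dvd (hle : ∀ p q : ℕ, p.Prime → q.Prime → p ≠ q → C q ≤ D p)
    (hdisj : ∀ p : ℕ, p.Prime → C p ⊓ D p = ⊥)
    (hcomm : ∀ p : ℕ, p.Prime → ∀ c ∈ C p, ∀ d ∈ D p, Commute c d)
    {p : ℕ} (hp : p.Prime) :
    posetTheta (PSubgroup.bot p (C p)) ∣ posetTheta (bot C) := by
  let B : Type _ := {K : Subgroup G // K ∈ primewiseIn C ∧ K ≤ D p}
  let j : PSubgroup p (C p) × B → primewiseIn C := fun x =>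
    ⟨x.1.1.map (C p).subtype ⊔ x.2.1, sup_mem hdisj hcomm hp (x.1.2.map _)
      (Subgroup.map_subtype_le _) x.2.2.1 x.2.2.2⟩
  let f : primewiseIn C → PSubgroup p (C p) × B := fun K =>
    (⟨K.1.subgroupOf (C p), by
      rw [← Subgroup.inf_subgroupOf_right]
      exact (isPGroup_inf hle hdisj K.2 hp).comap_subtype⟩,
    ⟨K.1 ⊓ D p, mono K.2 inf_le_left, inf_le_right⟩)
  have hf : ∀ K, f K = (PSubgroup.bot p (C p), ⟨⊥, bot_mem, bot_le⟩) ↔ K = bot C := by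
    intro K
    constructor
    · intro h
      refine Subtype.ext ((Subgroup.eq_bot_iff_forall _).2 fun x hx => ?_)
      have h1 : K.1.subgroupOf (C p) = ⊥ := congrArg (fun z => z.1.1) h
      have h2 : K.1 ⊓ D p = ⊥ := congrArg (fun z => z.2.1) h
      obtain ⟨s, t, h3, -, hC, hD⟩ := exists_split hle K.2 hp hx
      have h4 : x ^ s = 1 := by
        have : (⟨x ^ s, hC⟩ : C p) ∈ K.1.subgroupOf (C p) := K.1.pow_mem hx _
        rw [h1, Subgroup.mem_bot] at this
        exact congrArg Subtype.val this
      have h5 : x ^ t = 1 := by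
        rw [← Subgroup.mem_bot, ← h2]
        exact ⟨K.1.pow_mem hx _, hD⟩
      rw [← h3, h4, h5, one_mul]
    · rintro rfl
      refine Prod.ext (Subtype.ext ?_) (Subtype.ext ?_)
      · exact Subgroup.bot_subgroupOf _
      · exact bot_inf_eq _
  have h := posetTheta_eq_of_galois (j := j) (f := f) (fun x K => ?_) hf
  · rw [← h, posetTheta_prod]
    exact dvd_mul_right _ _
  · change _ ⊔ _ ≤ K.1 ↔ x.1.1 ≤ K.1.subgroupOf (C p) ∧ x.2.1 ≤ K.1 ⊓ D p
    rw [sup_le_iff, Subgroup.map_le_iff_le_comap, le_inf_iff, and_iff_left x.2.2.2]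
    rfl

theorem exists_conj_mem_of_isPGroup
    (hle : ∀ p q : ℕ, p.Prime → q.Prime → p ≠ q → C q ≤ D p)
    (hdisj : ∀ p : ℕ, p.Prime → C p ⊓ D p = ⊥)
    (hcomm : ∀ p : ℕ, p.Prime → ∀ c ∈ C p, ∀ d ∈ D p, Commute c d)
    {J : Subgroup G} (hJ : Maximal (· ∈ primewiseIn C) J)
    {p : ℕ} (hp : p.Prime) {A : Subgroup G} (hA : IsPGroup p A) (hAC : A ≤ C p) :
    ∃ c ∈ C p, ∀ x ∈ A, c * x * c⁻¹ ∈ J := by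
  have := Fact.mk hp
  have hJp : IsPGroup p (J.subgroupOf (C p)) := by
    rw [← Subgroup.inf_subgroupOf_right]
    exact (isPGroup_inf hle hdisj hJ.1 hp).comap_subtype
  obtain ⟨P, hP⟩ := hJp.exists_le_sylow
  obtain ⟨Q, hQ⟩ := (hA.comap_subtype (K := C p)).exists_le_sylow
  -- J is contained in P ⊔ (J ⊓ D p), which is again primewise in C, so maximality of J puts P
  -- inside J.
  have hPJ : P.1.map (C p).subtype ≤ J := by
    refine le_sup_left.trans (hJ.2 (sup_mem hdisj hcomm hp (P.2.map (C p).subtype)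
      (Subgroup.map_subtype_le _) (mono hJ.1 inf_le_left) (inf_le_right (a := J))) fun x hx => ?_)
    obtain ⟨s, t, h1, -, hC, hD⟩ := exists_split hle hJ.1 hp hx
    rw [← h1]
    refine Subgroup.mul_mem_sup ?_ ⟨J.pow_mem hx _, hD⟩
    exact ⟨⟨x ^ s, hC⟩, hP (J.pow_mem hx s : x ^ s ∈ J), rfl⟩
  obtain ⟨c, rfl⟩ := MulAction.exists_smul_eq (C p) P Q
  refine ⟨c⁻¹, inv_mem c.2, fun x hx => hPJ ?_⟩
  have h1 : (⟨x, hAC hx⟩ : C p) ∈ (c • P : Sylow p (C p)) := hQ hx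
  rw [← SetLike.mem_coe, Sylow.coe_smul, Set.mem_smul_set_iff_inv_smul_mem] at h1
  refine ⟨_, h1, ?_⟩
  rw [← map_inv, MulAut.smul_def, MulAut.conj_apply]
  rfl

/-- Maximal elements of `primewiseIn C` are conjugate. -/
theorem exists_conj_mem (hn : ∀ q : ℕ, (C q).Normal)
    (hle : ∀ p q : ℕ, p.Prime → q.Prime → p ≠ q → C q ≤ D p)
    (hdisj : ∀ p : ℕ, p.Prime → C p ⊓ D p = ⊥)
    (hcomm : ∀ p : ℕ, p.Prime → ∀ c ∈ C p, ∀ d ∈ D p, Commute c d)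
    {J K : Subgroup G} (hJ : Maximal (· ∈ primewiseIn C) J) (hK : K ∈ primewiseIn C) :
    ∃ g : G, ∀ x ∈ K, g * x * g⁻¹ ∈ J := by
  -- Primes are treated one at a time. The conjugator for p is taken in C p, which centralizes C q
  -- for q ≠ p, so the primes already treated are undisturbed.
  have key : ∀ S : Finset ℕ, (∀ q ∈ S, q.Prime) → ∃ g : G, ∀ q ∈ S, ∀ x ∈ K,
      (∃ k, x ^ q ^ k = 1) → g * x * g⁻¹ ∈ J := by
    intro S
    induction S using Finset.induction_on with
    | empty => exact fun _ => ⟨1, by simp⟩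
    | insert p S hpS ih =>
      intro hS
      obtain ⟨g, hg⟩ := ih fun q hq => hS q (Finset.mem_insert_of_mem hq)
      have hp : p.Prime := hS p (Finset.mem_insert_self _ _)
      have hconj : ∀ q : ℕ, q.Prime → ∀ x ∈ K, (∃ k, x ^ q ^ k = 1) → g * x * g⁻¹ ∈ C q :=
        fun q hq x hx hxq => (hn q).conj_mem _ (hK q hq x hx hxq) _
      have hK' : K.map (MulAut.conj g).toMonoidHom ∈ primewiseIn C := by
        rintro q hq _ ⟨x, hx, rfl⟩ ⟨k, hk⟩
        refine hconj q hq x hx ⟨k, ?_⟩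
        rw [← map_pow] at hk
        exact (MulAut.conj g).map_eq_one_iff.1 hk
      obtain ⟨c, hc, hcA⟩ := exists_conj_mem_of_isPGroup hle hdisj hcomm hJ hp
        (isPGroup_inf hle hdisj hK' hp) inf_le_right
      refine ⟨c * g, fun q hq x hx hxq => ?_⟩
      have he : c * g * x * (c * g)⁻¹ = c * (g * x * g⁻¹) * c⁻¹ := by group
      rw [he]
      rcases Finset.mem_insert.1 hq with rfl | hqS
      · exact hcA _ ⟨⟨x, hx, rfl⟩, hconj q hp x hx hxq⟩
      · have hqp : p ≠ q := fun h => hpS (h ▸ hqS)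
        have hq' := hS q hq
        rw [(hcomm p hp c hc _ (hle p q hp hq' hqp (hconj q hq' x hx hxq))).eq,
          mul_inv_cancel_right]
        exact hg q hqS x hx hxq
  obtain ⟨g, hg⟩ := key (Nat.card G).primeFactors fun q hq => Nat.prime_of_mem_primeFactors hq
  refine ⟨g, fun x hx => ?_⟩
  have : x ∈ J.comap (MulAut.conj g).toMonoidHom := by
    refine mem_of_forall_prime_part fun q hq y hy hyq => ?_
    have hyK : y ∈ K := (Subgroup.zpowers_le.2 hx) hy
    by_cases hqG : q ∣ Nat.card G
    · exact hg q (Nat.mem_primeFactors.2 ⟨hq, hqG, Nat.card_pos.ne'⟩) y hyK hyq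
    · obtain ⟨k, hk⟩ := hyq
      have : y = 1 := by
        rw [← orderOf_eq_one_iff]
        exact Nat.eq_one_of_dvd_coprimes ((hq.coprime_iff_not_dvd.2 hqG).pow_left k)
          (orderOf_dvd_of_pow_eq_one hk) (orderOf_dvd_natCard y)
      rw [this]
      exact one_mem _
  exact this

end primewiseIn

/-! ### Nilpotency and commuting elements of coprime order -/

/-- Elements of coprime orders of a finite nilpotent group commute. -/
theorem Group.IsNilpotent.commute_of_coprime {G : Type*} [Group G] [Finite G]
    (hG : Group.IsNilpotent G) {a b : ℕ} (hab : a.Coprime b) {x y : G} (hx : x ^ a = 1)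
    (hy : y ^ b = 1) : Commute x y := by
  obtain ⟨e⟩ := ((Group.isNilpotent_of_finite_tfae (G := G)).out 0 4).1 hG
  have key : Commute (e.symm x) (e.symm y) := by
    funext p P
    have hp : (p : ℕ).Prime := Nat.prime_of_mem_primeFactors p.2
    have hx' : e.symm x p P ^ a = 1 := by
      have := congrFun (congrFun (congrArg e.symm hx) p) P
      rwa [map_pow, map_one] at this
    have hy' : e.symm y p P ^ b = 1 := by
      have := congrFun (congrFun (congrArg e.symm hy) p) P
      rwa [map_pow, map_one] at this
    by_cases hpa : (p : ℕ) ∣ a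
    · obtain ⟨k, hk⟩ := P.2 (e.symm y p P)
      have hpb : (p : ℕ).Coprime b := hab.coprime_dvd_left hpa
      have h1 := eq_one_of_pow_eq_one_of_coprime (hpb.pow_left k) hk hy'
      change e.symm x p P * e.symm y p P = e.symm y p P * e.symm x p P
      rw [h1, mul_one, one_mul]
    · obtain ⟨k, hk⟩ := P.2 (e.symm x p P)
      have h1 := eq_one_of_pow_eq_one_of_coprime
        (((hp.coprime_iff_not_dvd).2 hpa).pow_left k) hk hx'
      change e.symm x p P * e.symm y p P = e.symm y p P * e.symm x p P
      rw [h1, mul_one, one_mul]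
  have := key.map e
  simpa using this

theorem Subgroup.commute_of_coprime_of_isNilpotent {G : Type*} [Group G] [Finite G]
    {K : Subgroup G} (hK : Group.IsNilpotent K) {a b : ℕ} (hab : a.Coprime b) {x y : G}
    (hxK : x ∈ K) (hyK : y ∈ K) (hx : x ^ a = 1) (hy : y ^ b = 1) : Commute x y :=
  congrArg Subtype.val (hK.commute_of_coprime hab (x := ⟨x, hxK⟩) (y := ⟨y, hyK⟩)
    (Subtype.ext hx) (Subtype.ext hy)).eq

/-- The normalizer of a Sylow p-subgroup contains a Sylow q-subgroup for every q, so it is the whole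
group. -/
theorem isNilpotent_of_commute {G : Type*} [Group G] [Finite G]
    (h : ∀ p q : ℕ, p.Prime → q.Prime → p ≠ q → ∀ x y : G, (∃ k, x ^ p ^ k = 1) →
      (∃ k, y ^ q ^ k = 1) → Commute x y) : Group.IsNilpotent G := by
  refine ((Group.isNilpotent_of_finite_tfae (G := G)).out 0 3).2 fun p hp P => ?_
  have hp : Fact p.Prime := hp
  rw [← Subgroup.normalizer_eq_top_iff, ← Subgroup.index_eq_one]
  by_contra hne
  obtain ⟨q, hq, hqd⟩ := Nat.exists_prime_and_dvd hne
  by_cases hpq : p = q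
  · subst hpq
    exact P.not_dvd_index (hqd.trans (Subgroup.index_dvd_of_le Subgroup.le_normalizer))
  · have := Fact.mk hq
    obtain ⟨Q⟩ : Nonempty (Sylow q G) := inferInstance
    refine Q.not_dvd_index (hqd.trans (Subgroup.index_dvd_of_le fun y hy => ?_))
    rw [Subgroup.mem_normalizer_iff]
    have hPy : ∀ x ∈ P, y * x * y⁻¹ = x := fun x hx => by
      obtain ⟨k, hk⟩ := P.2 ⟨x, hx⟩
      obtain ⟨l, hl⟩ := Q.2 ⟨y, hy⟩
      rw [← (h p q hp.out hq hpq x y ⟨k, congrArg Subtype.val hk⟩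
        ⟨l, congrArg Subtype.val hl⟩).eq, mul_inv_cancel_right]
    intro x
    refine ⟨fun hx => by rw [hPy x hx]; exact hx, fun hx => ?_⟩
    have h1 := hPy _ hx
    rw [mul_left_inj, mul_right_inj] at h1
    rwa [h1] at hx

theorem Subgroup.isNilpotent_mono {G : Type*} [Group G] {H K : Subgroup G}
    (hK : Group.IsNilpotent K) (h : H ≤ K) : Group.IsNilpotent H :=
  Group.nilpotent_of_mulEquiv (Subgroup.subgroupOfEquivOfLe h)

theorem Subgroup.isNilpotent_map {G H : Type*} [Group G] [Group H] (φ : G →* H) {K : Subgroup G}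
    (hK : Group.IsNilpotent K) : Group.IsNilpotent (K.map φ) :=
  Group.nilpotent_of_surjective (φ.subgroupMap K) (φ.subgroupMap_surjective K)

/-! ### Centralizers of the primary parts of F -/

/-- The centralizer of the elements of `F` whose `b`-th power is trivial. -/
def torsionCentralizer {G : Type*} [Group G] (F : Subgroup G) (b : ℕ) : Subgroup G :=
  Subgroup.centralizer {x | x ∈ F ∧ x ^ b = 1}

section torsionCentralizer

variable {G : Type*} [Group G] {F : Subgroup G} {a b : ℕ}

theorem mem_torsionCentralizer {c : G} :
    c ∈ torsionCentralizer F b ↔ ∀ x ∈ F, x ^ b = 1 → Commute c x := by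
  rw [torsionCentralizer, Subgroup.mem_centralizer_iff]
  exact ⟨fun h x hx hxb => (h x ⟨hx, hxb⟩).symm, fun h x hx => (h x hx.1 hx.2).symm⟩

theorem torsionCentralizer_anti (h : a ∣ b) : torsionCentralizer F b ≤ torsionCentralizer F a := by
  intro c hc
  rw [mem_torsionCentralizer] at hc ⊢
  exact fun x hx hxa => hc x hx (orderOf_dvd_iff_pow_eq_one.1
    ((orderOf_dvd_of_pow_eq_one hxa).trans h))

instance torsionCentralizer_normal [hF : F.Normal] : (torsionCentralizer F b).Normal := by
  refine ⟨fun c hc g => ?_⟩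
  rw [mem_torsionCentralizer] at hc ⊢
  intro x hx hxb
  have h1 : g⁻¹ * x * g ∈ F := by simpa using hF.conj_mem x hx g⁻¹
  have h2 : (g⁻¹ * x * g) ^ b = 1 := by
    have := conj_pow (i := b) (a := g⁻¹) (b := x)
    rw [inv_inv] at this
    rw [this, hxb, mul_one, inv_mul_cancel]
  have h3 := (hc _ h1 h2).map (MulAut.conj g)
  simpa [mul_assoc] using h3

theorem inf_torsionCentralizer_le (hF : Subgroup.centralizer (F : Set G) ≤ F)
    (hab : a.Coprime b) (hG : a * b = Nat.card G) {c : G} (hca : c ∈ torsionCentralizer F a)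
    (hcb : c ∈ torsionCentralizer F b) : c ∈ F ∧ ∀ f ∈ F, Commute c f := by
  have key : ∀ f ∈ F, Commute c f := by
    intro f hf
    obtain ⟨s, t, hst⟩ := exists_coprime_split hab
    obtain ⟨h1, h2, h3⟩ := (hst f).1 (by rw [hG]; exact pow_card_eq_one')
    rw [← h1]
    exact (mem_torsionCentralizer.1 hca _ (F.pow_mem hf _) h2).mul_right
      (mem_torsionCentralizer.1 hcb _ (F.pow_mem hf _) h3)
  exact ⟨hF (Subgroup.mem_centralizer_iff.2 fun f hf => (key f hf).eq.symm), key⟩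

/-- The `a`-part and the `b`-part of an element of `F` lie in the two centralizers. -/
theorem exists_split_mem_torsionCentralizer [Finite G] (hN : Group.IsNilpotent F)
    (hab : a.Coprime b) (hG : a * b = Nat.card G) {f : G} (hf : f ∈ F) :
    ∃ u ∈ F, ∃ v ∈ F, u * v = f ∧ u ^ a = 1 ∧ v ^ b = 1 ∧ Commute u v ∧
      u ∈ torsionCentralizer F b ∧ v ∈ torsionCentralizer F a := by
  obtain ⟨s, t, hst⟩ := exists_coprime_split hab
  obtain ⟨h1, h2, h3⟩ := (hst f).1 (by rw [hG]; exact pow_card_eq_one')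
  refine ⟨f ^ s, F.pow_mem hf _, f ^ t, F.pow_mem hf _, h1, h2, h3, Commute.pow_pow_self _ _ _,
    mem_torsionCentralizer.2 fun x hx hxb => ?_, mem_torsionCentralizer.2 fun x hx hxa => ?_⟩
  · exact Subgroup.commute_of_coprime_of_isNilpotent hN hab (F.pow_mem hf _) hx h2 hxb
  · exact Subgroup.commute_of_coprime_of_isNilpotent hN hab.symm (F.pow_mem hf _) hx h3 hxa

/-- Write f = uv with u the a-part and v the b-part. Then cu lies in the centralizer and commutes
with v, so the power s removes v from x = (cu)v and fixes x. -/
theorem mem_torsionCentralizer_of_mul [Finite G] (hN : Group.IsNilpotent F)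
    (hab : a.Coprime b) (hG : a * b = Nat.card G) {x c f : G} (hc : c ∈ torsionCentralizer F b) (hf : f ∈ F)
    (hx : x = c * f) (hxa : x ^ a = 1) : x ∈ torsionCentralizer F b := by
  obtain ⟨u, hu, v, hv, rfl, hua, hvb, huv, huC, -⟩ :=
    exists_split_mem_torsionCentralizer hN hab hG hf
  obtain ⟨s, t, hst⟩ := exists_coprime_split hab
  have hc' : c * u ∈ torsionCentralizer F b := mul_mem hc huC
  have hcv : Commute (c * u) v := mem_torsionCentralizer.1 hc' v hv hvb
  have h1 : x ^ s = (c * u) ^ s := by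
    rw [hx, ← mul_assoc, hcv.mul_pow, ((hst v).2.2 hvb).1, mul_one]
  rw [((hst x).2.1 hxa).1] at h1
  rw [h1]
  exact pow_mem hc' _

/-- The commutator z lies in both centralizers, hence in Z(F), and it remains to kill its b-part z ^
t. Since xz is conjugate to x, (x z ^ s) ^ a is the inverse of (z ^ t) ^ a, a b-torsion element.
Modulo the normal a-torsion subgroup V it is x ^ a = 1, so it is also a-torsion, hence trivial. -/
theorem commutator_pow_eq_one [F.Normal] (hF : Subgroup.centralizer (F : Set G) ≤ F)
    (hab : a.Coprime b) (hG : a * b = Nat.card G) {x y : G}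
    (hx : x ∈ torsionCentralizer F b) (hxa : x ^ a = 1) (hy : y ∈ torsionCentralizer F a) :
    (x⁻¹ * (y * x * y⁻¹)) ^ a = 1 := by
  set z := x⁻¹ * (y * x * y⁻¹) with hz
  have hzb : z ∈ torsionCentralizer F b :=
    mul_mem (inv_mem hx) (torsionCentralizer_normal.conj_mem x hx y)
  have hza : z ∈ torsionCentralizer F a := by
    have : z = (x⁻¹ * y * x⁻¹⁻¹) * y⁻¹ := by rw [hz]; group
    rw [this]
    exact mul_mem (torsionCentralizer_normal.conj_mem y hy x⁻¹) (inv_mem hy)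
  obtain ⟨s, t, hst⟩ := exists_coprime_split hab
  obtain ⟨h1, h2, h3⟩ := (hst z).1 (by rw [hG]; exact pow_card_eq_one')
  have hzF := (inf_torsionCentralizer_le hF hab hG hza hzb).1
  let V : Subgroup G :=
    { carrier := {v | (v ∈ torsionCentralizer F a ∧ v ∈ torsionCentralizer F b) ∧ v ^ a = 1}
      one_mem' := ⟨⟨one_mem _, one_mem _⟩, one_pow _⟩
      mul_mem' := fun {u v} hu hv => ⟨⟨mul_mem hu.1.1 hv.1.1, mul_mem hu.1.2 hv.1.2⟩, by
        have := (inf_torsionCentralizer_le hF hab hG hu.1.1 hu.1.2).2 v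
          (inf_torsionCentralizer_le hF hab hG hv.1.1 hv.1.2).1
        rw [this.mul_pow, hu.2, hv.2, one_mul]⟩
      inv_mem' := fun {u} hu => ⟨⟨inv_mem hu.1.1, inv_mem hu.1.2⟩, by
        rw [inv_pow, hu.2, inv_one]⟩ }
  have hV : V.Normal := ⟨fun v hv g => ⟨⟨torsionCentralizer_normal.conj_mem v hv.1.1 g,
    torsionCentralizer_normal.conj_mem v hv.1.2 g⟩, by
      rw [conj_pow, hv.2, mul_one, mul_inv_cancel]⟩⟩
  have hvV : z ^ s ∈ V := ⟨⟨pow_mem hza _, pow_mem hzb _⟩, h2⟩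
  have hcomm : Commute (x * z ^ s) (z ^ t) :=
    (mem_torsionCentralizer.1 hx _ (F.pow_mem hzF _) h3).mul_left (Commute.pow_pow_self _ _ _)
  have hxz : (x * z ^ s * z ^ t) ^ a = 1 := by
    rw [mul_assoc, h1, hz, mul_inv_cancel_left, conj_pow, hxa, mul_one, mul_inv_cancel]
  rw [hcomm.mul_pow] at hxz
  have hxV : (x * z ^ s) ^ a ∈ V := by
    rw [← QuotientGroup.eq_one_iff, QuotientGroup.mk_pow, QuotientGroup.mk_mul,
      (QuotientGroup.eq_one_iff _).2 hvV, mul_one, ← QuotientGroup.mk_pow, hxa,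
      QuotientGroup.mk_one]
  rw [eq_inv_of_mul_eq_one_left hxz] at hxV
  have h4 : (z ^ t) ^ a = 1 := by
    have h5 : ((z ^ t) ^ a) ^ a = 1 := by simpa using hxV.2
    refine eq_one_of_pow_eq_one_of_coprime hab h5 ?_
    rw [pow_right_comm, h3, one_pow]
  have h5 : z ^ t = 1 := eq_one_of_pow_eq_one_of_coprime hab h4 h3
  rw [h5, mul_one] at h1
  rwa [h1] at h2

/-- The commutator is a-torsion; with the roles of x and y exchanged, a conjugate of its inverse is
b-torsion. -/
theorem commute_of_mem_torsionCentralizer [F.Normal]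
    (hF : Subgroup.centralizer (F : Set G) ≤ F)
    (hab : a.Coprime b) (hG : a * b = Nat.card G) {x y : G}
    (hx : x ∈ torsionCentralizer F b) (hxa : x ^ a = 1) (hy : y ∈ torsionCentralizer F a)
    (hyb : y ^ b = 1) : Commute x y := by
  have h1 := commutator_pow_eq_one hF hab hG hx hxa hy
  have h2 := commutator_pow_eq_one hF hab.symm (by rw [mul_comm, hG]) hy hyb hx
  have h3 : y⁻¹ * (x * y * x⁻¹) =
      (x * y⁻¹) * (x⁻¹ * (y * x * y⁻¹))⁻¹ * (x * y⁻¹)⁻¹ := by group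
  have h4 : y⁻¹ * (x * y * x⁻¹) = 1 := by
    refine eq_one_of_pow_eq_one_of_coprime hab ?_ h2
    rw [h3, conj_pow, inv_pow, h1, inv_one, mul_one, mul_inv_cancel]
  rw [inv_mul_eq_one, eq_mul_inv_iff_mul_eq] at h4
  exact h4.symm

end torsionCentralizer

theorem ordProj_dvd_ordCompl {p q : ℕ} (hp : p.Prime) (hq : q.Prime) (hpq : p ≠ q) (n : ℕ) :
    p ^ n.factorization p ∣ n / q ^ n.factorization q := by
  refine (Nat.coprime_pow_primes (n.factorization p) (n.factorization q) hp hq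
    hpq).dvd_of_dvd_mul_left ?_
  rw [Nat.ordProj_mul_ordCompl_eq_self]
  exact Nat.ordProj_dvd _ _

theorem Subgroup.relIndex_eq_relIndex_sup_of_normal {G : Type*} [Group G] [Finite G]
    (H K : Subgroup G) [K.Normal] : H.relIndex K = H.relIndex (H ⊔ K) := by
  have h1 := Subgroup.relIndex_mul_relIndex (H ⊓ K) K (H ⊔ K) inf_le_right le_sup_right
  have h2 := Subgroup.relIndex_mul_relIndex (H ⊓ K) H (H ⊔ K) inf_le_left le_sup_left
  rw [Subgroup.inf_relIndex_right, Subgroup.relIndex_sup_right] at h1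
  rw [Subgroup.inf_relIndex_left, ← h1, mul_comm] at h2
  exact (Nat.eq_of_mul_eq_mul_right
    (Nat.pos_of_ne_zero Subgroup.index_ne_zero_of_finite) h2).symm

/-! ### Nilpotent subgroups above F, seen in G/F -/

section fittingQuotient

variable {G : Type*} [Group G] (F : Subgroup G) [F.Normal]

/-- The image in `G ⧸ F` of the centralizer of the `p'`-elements of `F`. -/
noncomputable def primeCentralizer (p : ℕ) : Subgroup (G ⧸ F) :=
  (torsionCentralizer F (Nat.card G / p ^ (Nat.card G).factorization p)).map (QuotientGroup.mk' F)

/-- The image in `G ⧸ F` of the centralizer of the `p`-elements of `F`. -/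
noncomputable def coprimeCentralizer (p : ℕ) : Subgroup (G ⧸ F) :=
  (torsionCentralizer F (p ^ (Nat.card G).factorization p)).map (QuotientGroup.mk' F)

instance primeCentralizer_normal (p : ℕ) : (primeCentralizer F p).Normal :=
  Subgroup.Normal.map torsionCentralizer_normal _ (QuotientGroup.mk'_surjective F)

theorem primeCentralizer_le {p q : ℕ} (hp : p.Prime) (hq : q.Prime) (hpq : p ≠ q) :
    primeCentralizer F q ≤ coprimeCentralizer F p := by
  refine Subgroup.map_mono (torsionCentralizer_anti (ordProj_dvd_ordCompl hp hq hpq _))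

variable {F} [Finite G]

/-- Two representatives c, d of a common coset differ by f = uv in F. Moving u to c and v to d gives
one element in both centralizers, hence in F. -/
theorem primeCentralizer_inf (hF : Subgroup.centralizer (F : Set G) ≤ F)
    (hN : Group.IsNilpotent F) {p : ℕ} (hp : p.Prime) :
    primeCentralizer F p ⊓ coprimeCentralizer F p = ⊥ := by
  rw [Subgroup.eq_bot_iff_forall]
  rintro _ ⟨⟨c, hc, rfl⟩, d, hd, hcd⟩
  have hab := (Nat.coprime_ordCompl hp (Nat.card_pos (α := G)).ne').pow_left
    ((Nat.card G).factorization p)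
  have hG := Nat.ordProj_mul_ordCompl_eq_self (Nat.card G) p
  have hf : d⁻¹ * c ∈ F := QuotientGroup.eq.1 hcd
  obtain ⟨u, hu, v, hv, huv, -, -, hcomm, huC, hvD⟩ :=
    exists_split_mem_torsionCentralizer hN hab hG hf
  have h1 : d * v = c * u⁻¹ := by
    rw [eq_mul_inv_iff_mul_eq, mul_assoc, ← hcomm.eq, huv, mul_inv_cancel_left]
  have h2 : c * u⁻¹ ∈ F := (inf_torsionCentralizer_le hF hab hG
    (h1 ▸ mul_mem hd hvD) (mul_mem hc (inv_mem huC))).1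
  refine (QuotientGroup.eq_one_iff c).2 ?_
  simpa using mul_mem h2 hu

theorem primeCentralizer_commute (hF : Subgroup.centralizer (F : Set G) ≤ F) {p : ℕ}
    (hp : p.Prime) : ∀ c ∈ primeCentralizer F p, ∀ d ∈ coprimeCentralizer F p, Commute c d := by
  rintro _ ⟨c, hc, rfl⟩ _ ⟨d, hd, rfl⟩
  have hab := (Nat.coprime_ordCompl hp (Nat.card_pos (α := G)).ne').pow_left
    ((Nat.card G).factorization p)
  have hG := Nat.ordProj_mul_ordCompl_eq_self (Nat.card G) p
  refine QuotientGroup.eq.2 (inf_torsionCentralizer_le hF hab hG ?_ ?_).1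
  · have : (c * d)⁻¹ * (d * c) = d⁻¹ * (c⁻¹ * d * c⁻¹⁻¹) := by group
    rw [this]
    exact mul_mem (inv_mem hd) (torsionCentralizer_normal.conj_mem d hd _)
  · have : (c * d)⁻¹ * (d * c) = d⁻¹ * c⁻¹ * d⁻¹⁻¹ * c := by group
    rw [this]
    exact mul_mem (torsionCentralizer_normal.conj_mem _ (inv_mem hc) _) hc

/-- The image of a nilpotent subgroup containing `F`. -/
theorem map_mem_primewiseIn {K : Subgroup G} (hFK : F ≤ K) (hK : Group.IsNilpotent K) :
    K.map (QuotientGroup.mk' F) ∈ primewiseIn (primeCentralizer F) := by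
  rintro p hp _ ⟨x, hx, rfl⟩ hxp
  have hab := (Nat.coprime_ordCompl hp (Nat.card_pos (α := G)).ne').pow_left
    ((Nat.card G).factorization p)
  have hG := Nat.ordProj_mul_ordCompl_eq_self (Nat.card G) p
  obtain ⟨s, t, hst⟩ := exists_coprime_split hab
  have hxG : x ^ Nat.card G = 1 := pow_card_eq_one'
  have h1 := pow_ordProj_eq_one hp (Nat.card_pos (α := G)).ne'
    (x := QuotientGroup.mk' F x) (by rw [← map_pow, hxG, map_one]) hxp
  -- The p-part of x has the same image as x in G/F, and nilpotency of K makes it centralize the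
  -- p'-elements of F.
  refine ⟨x ^ s, mem_torsionCentralizer.2 fun f hf hfb => ?_, ?_⟩
  · exact Subgroup.commute_of_coprime_of_isNilpotent hK hab (K.pow_mem hx _) (hFK hf)
      ((hst x).1 (by rw [hG, hxG])).2.1 hfb
  · rw [map_pow]
    exact ((hst (QuotientGroup.mk' F x)).2.1 h1).1

theorem isNilpotent_comap (hF : Subgroup.centralizer (F : Set G) ≤ F) (hN : Group.IsNilpotent F)
    {K : Subgroup (G ⧸ F)} (hK : K ∈ primewiseIn (primeCentralizer F)) :
    Group.IsNilpotent (K.comap (QuotientGroup.mk' F)) := by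
  have lift : ∀ p : ℕ, p.Prime → ∀ x ∈ K.comap (QuotientGroup.mk' F), (∃ k, x ^ p ^ k = 1) →
      x ^ p ^ (Nat.card G).factorization p = 1 ∧
      x ∈ torsionCentralizer F (Nat.card G / p ^ (Nat.card G).factorization p) := by
    intro p hp x hx hxp
    have hab := (Nat.coprime_ordCompl hp (Nat.card_pos (α := G)).ne').pow_left
      ((Nat.card G).factorization p)
    have hG := Nat.ordProj_mul_ordCompl_eq_self (Nat.card G) p
    have hxa := pow_ordProj_eq_one hp (Nat.card_pos (α := G)).ne' pow_card_eq_one' hxp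
    obtain ⟨c, hc, hcx⟩ := hK p hp _ hx (by
      obtain ⟨k, hk⟩ := hxp
      exact ⟨k, by rw [← map_pow, hk, map_one]⟩)
    exact ⟨hxa, mem_torsionCentralizer_of_mul hN hab hG hc (QuotientGroup.eq.1 hcx)
      (mul_inv_cancel_left c x).symm hxa⟩
  refine isNilpotent_of_commute fun p q hp hq hpq x y hx hy => Subtype.ext ?_
  have hval : ∀ (r : ℕ) (z : K.comap (QuotientGroup.mk' F)), (∃ k, z ^ r ^ k = 1) →
      ∃ k, (z : G) ^ r ^ k = 1 := fun r z ⟨k, hk⟩ => ⟨k, congrArg Subtype.val hk⟩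
  obtain ⟨hxa, hxC⟩ := lift p hp x x.2 (hval p x hx)
  obtain ⟨hya, hyC⟩ := lift q hq y y.2 (hval q y hy)
  refine (commute_of_mem_torsionCentralizer hF ((Nat.coprime_ordCompl hp
    (Nat.card_pos (α := G)).ne').pow_left _) (Nat.ordProj_mul_ordCompl_eq_self (Nat.card G) p)
    hxC hxa (torsionCentralizer_anti (ordProj_dvd_ordCompl hp hq hpq _) hyC) ?_).eq
  exact orderOf_dvd_iff_pow_eq_one.1 ((orderOf_dvd_of_pow_eq_one hya).trans
    (ordProj_dvd_ordCompl hq hp (Ne.symm hpq) _))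

end fittingQuotient

/-! ### Injectors and the part of X above F -/

section injector

variable {G : Type*} [Group G]

instance fittingSubgroup_normal : (fittingSubgroup G).Normal :=
  Subgroup.sSup_normal _ fun _ h => h.1

variable {I : Subgroup G}

theorem IsNilpotentInjector.maximal (hI : IsNilpotentInjector I) :
    Maximal (fun K : Subgroup G => Group.IsNilpotent K) I := by
  have h := hI ⊤ Subgroup.IsSubnormal.top
  simpa using h

/-- A normal nilpotent N is the only maximal nilpotent subgroup of itself, so N ⊓ I = N. Nilpotency
of F(G) then follows from that of I. -/
theorem IsNilpotentInjector.fittingSubgroup_le (hI : IsNilpotentInjector I) :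
    fittingSubgroup G ≤ I :=
  sSup_le fun N hN =>
    ((hI N hN.1.isSubnormal).2 ⟨le_rfl, hN.2⟩ inf_le_left).trans inf_le_right

theorem maximal_map_mk [Finite G] (hG : IsNConstrained G) (hI : IsNilpotentInjector I) :
    Maximal (· ∈ primewiseIn (primeCentralizer (fittingSubgroup G)))
      (I.map (QuotientGroup.mk' (fittingSubgroup G))) := by
  have hF := hI.fittingSubgroup_le
  have hN : Group.IsNilpotent (fittingSubgroup G) :=
    Subgroup.isNilpotent_mono hI.maximal.1 hF
  refine ⟨map_mem_primewiseIn hF hI.maximal.1, fun K hK hIK => ?_⟩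
  rw [Subgroup.map_le_iff_le_comap] at hIK
  have h := hI.maximal.2 (isNilpotent_comap hG hN hK) hIK
  have h1 := Subgroup.map_mono (f := QuotientGroup.mk' (fittingSubgroup G)) h
  rwa [Subgroup.map_comap_eq_self_of_surjective (QuotientGroup.mk'_surjective _)] at h1

theorem fittingSubgroup_mem_subgroupsOfConjugates (hI : IsNilpotentInjector I) :
    fittingSubgroup G ∈ subgroupsOfConjugates I := by
  refine ⟨1, fun x hx => ⟨x, hI.fittingSubgroup_le hx, ?_⟩⟩
  simp

theorem comap_mk_mem_subgroupsOfConjugates [Finite G] (hG : IsNConstrained G)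
    (hI : IsNilpotentInjector I) {K : Subgroup (G ⧸ fittingSubgroup G)}
    (hK : K ∈ primewiseIn (primeCentralizer (fittingSubgroup G))) :
    K.comap (QuotientGroup.mk' (fittingSubgroup G)) ∈ subgroupsOfConjugates I := by
  have hN : Group.IsNilpotent (fittingSubgroup G) :=
    Subgroup.isNilpotent_mono hI.maximal.1 hI.fittingSubgroup_le
  obtain ⟨g, hg⟩ := primewiseIn.exists_conj_mem
    (fun q => primeCentralizer_normal (fittingSubgroup G) q)
    (fun p q hp hq hpq => primeCentralizer_le _ hp hq hpq)
    (fun p hp => primeCentralizer_inf hG hN hp)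
    (fun p hp => primeCentralizer_commute hG hp) (maximal_map_mk hG hI) hK
  obtain ⟨g, rfl⟩ := QuotientGroup.mk'_surjective _ g
  refine ⟨g⁻¹, fun x hx => ?_⟩
  have h1 := hg _ hx
  rw [← map_mul, ← map_inv, ← map_mul, ← Subgroup.mem_comap, Subgroup.comap_map_eq,
    QuotientGroup.ker_mk', sup_eq_left.2 hI.fittingSubgroup_le] at h1
  exact ⟨_, h1, by simp [mul_assoc]⟩

/-- Preimages identify `primewiseIn` with the members of X containing F; this is an upper set, so θ
is unchanged. -/
theorem posetTheta_fittingSubgroup [Finite G] (hG : IsNConstrained G)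
    (hI : IsNilpotentInjector I) :
    posetTheta (⟨fittingSubgroup G, fittingSubgroup_mem_subgroupsOfConjugates hI⟩ :
      subgroupsOfConjugates I) =
    posetTheta (primewiseIn.bot (primeCentralizer (fittingSubgroup G))) := by
  let e : primewiseIn (primeCentralizer (fittingSubgroup G)) ↪o subgroupsOfConjugates I :=
    OrderEmbedding.ofMapLEIff
      (fun K => ⟨K.1.comap (QuotientGroup.mk' (fittingSubgroup G)),
        comap_mk_mem_subgroupsOfConjugates hG hI K.2⟩)
      fun K L => Subgroup.comap_le_comap_of_surjective (QuotientGroup.mk'_surjective _)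
  have he : e (primewiseIn.bot _) =
      ⟨fittingSubgroup G, fittingSubgroup_mem_subgroupsOfConjugates hI⟩ := by
    refine Subtype.ext ?_
    change (⊥ : Subgroup _).comap (QuotientGroup.mk' (fittingSubgroup G)) = _
    rw [MonoidHom.comap_bot, QuotientGroup.ker_mk']
  rw [← he]
  refine posetTheta_upper e (fun K L hKL => ?_) _
  have hFL : fittingSubgroup G ≤ L.1 := by
    refine le_trans ?_ (show K.1.comap (QuotientGroup.mk' (fittingSubgroup G)) ≤ L.1 from hKL)
    intro x hx
    rw [Subgroup.mem_comap, QuotientGroup.mk'_apply, (QuotientGroup.eq_one_iff x).2 hx]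
    exact one_mem _
  obtain ⟨g, hg⟩ := L.2
  have hL : Group.IsNilpotent L.1 :=
    Subgroup.isNilpotent_mono (Subgroup.isNilpotent_map _ hI.maximal.1) hg
  refine ⟨⟨_, map_mem_primewiseIn hFL hL⟩, Subtype.ext ?_⟩
  change (L.1.map _).comap (QuotientGroup.mk' (fittingSubgroup G)) = L.1
  rw [Subgroup.comap_map_eq, QuotientGroup.ker_mk', sup_eq_left.2 hFL]

end injector

/-! ### The main divisibility -/

theorem mainTheorem8 {G : Type*} [Group G] [Finite G] [Nontrivial G]
    (hG : IsNConstrained G) (I : Subgroup G) (hI : IsNilpotentInjector I)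
    (hn : 1 < (fittingSubgroup G).relIndex I) :
    ∃ hF : fittingSubgroup G ∈ subgroupsOfConjugates I,
      ((Nat.lcm (injectorModulus G) ((fittingSubgroup G).relIndex I) : ℕ) : ℤ) ∣
        posetTheta (⟨fittingSubgroup G, hF⟩ : subgroupsOfConjugates I) := by
  refine ⟨fittingSubgroup_mem_subgroupsOfConjugates hI, ?_⟩
  rw [posetTheta_fittingSubgroup hG hI]
  have hN : Group.IsNilpotent (fittingSubgroup G) :=
    Subgroup.isNilpotent_mono hI.maximal.1 hI.fittingSubgroup_le
  have hdvd : ∀ p : ℕ, p.Prime → _ ∣ _ := fun p hp => primewiseIn.posetTheta_dvd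
    (fun p q hp hq hpq => primeCentralizer_le (fittingSubgroup G) hp hq hpq)
    (fun p hp => primeCentralizer_inf hG hN hp)
    (fun p hp => primeCentralizer_commute hG hp) hp
  have hmax := maximal_map_mk hG hI
  set Ibar := I.map (QuotientGroup.mk' (fittingSubgroup G)) with hIbar
  have hcard : (fittingSubgroup G).relIndex I = Nat.card Ibar := by
    rw [hIbar, ← Subgroup.relIndex_ker, QuotientGroup.ker_mk']
  have hord : ∀ p : ℕ, p.Prime → p ^ (Nat.card Ibar).factorization p ∣
      Nat.card (primeCentralizer (fittingSubgroup G) p) := by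
    intro p hp
    have := Fact.mk hp
    obtain ⟨P⟩ : Nonempty (Sylow p Ibar) := inferInstance
    rw [← P.card_eq_multiplicity,
      ← Subgroup.card_map_of_injective (K := P.1) Ibar.subtype_injective]
    refine Subgroup.card_dvd_of_le ?_
    rintro _ ⟨x, hx, rfl⟩
    obtain ⟨k, hk⟩ := P.2 ⟨x, hx⟩
    exact hmax.1 p hp x x.2 ⟨k, congrArg Subtype.val (congrArg Subtype.val hk)⟩
  rw [hcard] at hn ⊢
  rw [Int.natCast_dvd]
  refine Nat.lcm_dvd ?_ ?_
  · classical
    unfold injectorModulus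
    split_ifs
    · exact one_dvd _
    · rw [← Int.natCast_dvd]
      obtain ⟨p, hp, hpn⟩ := Nat.exists_prime_and_dvd hn.ne'
      have hpC : p ∣ Nat.card (primeCentralizer (fittingSubgroup G) p) :=
        (dvd_pow_self p (hp.factorization_pos_of_dvd Nat.card_pos.ne' hpn).ne').trans (hord p hp)
      refine (PSubgroup.dvd_posetTheta_bot hp _ hpC fun q hq hqp hqC => ?_).trans (hdvd p hp)
      -- I/F meets C_p in a p-group, so q divides the index of the intersection in C_p; as C_p is
      -- normal, this index divides (G:I).
      have hqI : q ∣ I.index := by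
        have h1 : Ibar.index = I.index := Subgroup.index_map_eq I
          (QuotientGroup.mk'_surjective _) (by
            rw [QuotientGroup.ker_mk']
            exact hI.fittingSubgroup_le)
        rw [← h1]
        have h2 : Ibar.relIndex (primeCentralizer (fittingSubgroup G) p) ∣ Ibar.index := by
          rw [Subgroup.relIndex_eq_relIndex_sup_of_normal]
          exact Subgroup.relIndex_dvd_index_of_le le_sup_left
        refine Dvd.dvd.trans ?_ h2
        have hIp : IsPGroup p (Ibar.subgroupOf (primeCentralizer (fittingSubgroup G) p)) := by
          rw [← Subgroup.inf_subgroupOf_right]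
          exact (primewiseIn.isPGroup_inf
            (fun p q hp hq hpq => primeCentralizer_le (fittingSubgroup G) hp hq hpq)
            (fun p hp => primeCentralizer_inf hG hN hp) hmax.1 hp).comap_subtype
        have := Fact.mk hp
        obtain ⟨k, hk⟩ := hIp.exists_card_eq
        rw [← Subgroup.card_mul_index, hk] at hqC
        exact (Nat.Coprime.pow_right k ((Nat.coprime_primes hq hp).2 hqp)).dvd_of_dvd_mul_left hqC
      refine Finset.gcd_dvd (Finset.mem_filter.2 ⟨Nat.mem_primeFactors.2
        ⟨hq, hqI.trans I.index_dvd_card, Nat.card_pos.ne'⟩, I, hI, hqI⟩)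
  · rw [Nat.dvd_iff_prime_pow_dvd_dvd]
    intro p k hp hk
    rw [← Int.natCast_dvd]
    refine Dvd.dvd.trans ?_ ((PSubgroup.ordProj_dvd_posetTheta_bot hp _).trans (hdvd p hp))
    rw [Int.natCast_dvd_natCast]
    refine pow_dvd_pow _ ?_
    rw [← hp.pow_dvd_iff_le_factorization Nat.card_pos.ne']
    refine Dvd.dvd.trans (pow_dvd_pow _ ?_) (hord p hp)
    rwa [← hp.pow_dvd_iff_le_factorization Nat.card_pos.ne']
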